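/- Let $\mathsf h$ be a complex Hilbert space, $\rho$ a faithful density operator on $\mathsf h$ (positive, $\operatorname{tr}\rho=1$, $\ker\rho=0$), $\theta$ an anti-unitary operator with $\theta^2=1$ and $\theta\rho=\rho\theta$, and $\Theta(x)=\theta x^*\theta$. Let $\mathcal T=(\mathcal T_t)_{t\ge 0}$ and $\mathcal T^\Theta=(\mathcal T^\Theta_t)_{t\ge0}$ be uniformly continuous quantum Markov semigroups (norm continuous semigroups of normal unital completely positive maps) on $\mathcal B(\mathsf h)$, such that $\rho$ is invariant for $\mathcal T$ and $\mathcal T^\Theta$ is the $\Theta$-KMS adjoint of $\mathcal T$, i.e. $$\operatorname{tr}\big(\rho^{1/2}\Theta(x^*)\rho^{1/2}\mathcal T_t(y)\big)=\operatorname{tr}\big(\rho^{1/2}\Theta(\mathcal T^\Theta_t(x^*))\rho^{1/2}y\big)\qquad (t\ge 0,\ x,y\in\mathcal B(\mathsf h)).$$ Let $\mathcal T_{*t},\mathcal T^\Theta_{*t}$ be the pre-dual maps on trace class operators. Fix an orthonormal basis $(e_i)$ of $\mathsf h$. For $\Phi_*\in\{\mathcal T_{*t},\mathcal T^\Theta_{*t}\}$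 let $\mathcal J_\rho(\Phi_*)=(1\otimes\Phi_*)\big(\sum_{i,j}|e_i\rangle\langle e_j|\otimes\rho^{1/2}|e_i\rangle\langle e_j|\rho^{1/2}\big)$ be the bounded operator on $\mathsf h\otimes\mathsf h$ with matrix elements $$\langle e_k\otimes e_l,\mathcal J_\rho(\Phi_*)\,e_{k'}\otimes e_{l'}\rangle=\langle e_l,\Phi_*(|\rho^{1/2}e_k\rangle\langle\rho^{1/2}e_{k'}|)e_{l'}\rangle .$$ These operators exist and are states (density operators). The relative entropy of two states is $S(\eta,\sigma)=\operatorname{tr}(\eta\log\eta-\eta\log\sigma)$ if $\ker\sigma\subset\ker\eta$ and $+\infty$ otherwise; write $S(\mathcal T_{*t},\mathcal T^\Theta_{*t})=S(\mathcal J_\rho(\mathcal T_{*t}),\mathcal J_\rho(\mathcal T^\Theta_{*t}))$. Let $t\ge0$ and assume $\ker\mathcal J_\rho(\mathcal T^\Theta_{*t})\subset\ker\mathcal J_\rho(\mathcal T_{*t})$. Then the two kernels are equal, and $$S(\mathcal T_{*t},\mathcal T^\Theta_{*t})=\tfrac12\operatorname{tr}\Big(\big(\mathcal J_\rho(\mathcal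 T_{*t})-\mathcal J_\rho(\mathcal T^\Theta_{*t})\big)\big(\log\mathcal J_\rho(\mathcal T_{*t})-\log\mathcal J_\rho(\mathcal T^\Theta_{*t})\big)\Big)$$ as an identity of extended real numbers. Here, since logarithms of states are in general unbounded, the traces are the spectral ones: if $\eta=\sum_r rP_r$ and $\sigma=\sum_s sQ_s$ are the spectral decompositions, then $\operatorname{tr}(\eta\log\eta-\eta\log\sigma)=\sum_{r,s}(r\log r-r\log s)\operatorname{tr}(P_rQ_s)$ and $\operatorname{tr}((\eta-\sigma)(\log\eta-\log\sigma))=\sum_{r,s}(r-s)(\log r-\log s)\operatorname{tr}(P_rQ_s)$, with $\log 0:=0$ (pairs with exactly one of $r,s$ equal to $0$ either have $\operatorname{tr}(P_rQ_s)=0$ or contribute $0$). If $\mathsf h$ is finite-dimensional, the formula holds with the ordinary trace and the ordinary logarithm (set to $0$ on the common kernel). -/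

import Mathlib

open scoped InnerProductSpace TensorProduct NNReal ENNReal Topology

namespace QMS

noncomputable section

section Trace

variable {H : Type*} [NormedAddCommGroup H] [InnerProductSpace ℂ H] [CompleteSpace H]

/-- The index set of a chosen orthonormal (Hilbert) basis of `H`. -/
def onbIndex (H : Type*) [NormedAddCommGroup H] [InnerProductSpace ℂ H] [CompleteSpace H] :
    Set H :=
  (exists_hilbertBasis ℂ H).choose

/-- A chosen orthonormal basis of `H`, used to compute traces (which do not depend on it). -/
def onb (H : Type*) [NormedAddCommGroup H] [InnerProductSpace ℂ H] [CompleteSpace H] :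
    HilbertBasis (onbIndex H) ℂ H :=
  (exists_hilbertBasis ℂ H).choose_spec.choose

/-- `A` is trace class: `tr |A| < ∞`. -/
def IsTraceClass (A : H →L[ℂ] H) : Prop :=
  Summable fun i => ⟪onb H i, CFC.abs A (onb H i)⟫_ℂ

/-- The trace of a (trace class) operator. -/
def opTrace (A : H →L[ℂ] H) : ℂ :=
  ∑' i, ⟪onb H i, A (onb H i)⟫_ℂ

/-- States, as density operators: positive trace class operators of trace one. -/
def IsState (A : H →L[ℂ] H) : Prop :=
  0 ≤ A ∧ IsTraceClass A ∧ opTrace A = 1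

/-- The orthogonal projection onto the eigenspace `{v | A v = r v}` (zero if `r` is not an
eigenvalue). -/
def eigenProj (A : H →L[ℂ] H) (r : ℝ) : H →L[ℂ] H :=
  (A - (r : ℂ) • (1 : H →L[ℂ] H)).ker.starProjection

/-- `tr (P Q) = tr (P Q P) ∈ [0, ∞]`, for `P` the eigenprojection of `A` at `r` and `Q` the
eigenprojection of `B` at `s`. -/
def overlap (A B : H →L[ℂ] H) (r s : ℝ) : ℝ≥0∞ :=
  ∑' i, ENNReal.ofReal (‖eigenProj B s (eigenProj A r (onb H i))‖ ^ 2)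

/-- The extended-real-valued trace of an expression in `A` and `B` whose terms have the form
`f(A) g(B)` (or `g(B) f(A)`), where `A`, `B` are positive with discrete spectrum (for instance
states) and `f(A)`, `g(B)` may be unbounded operators, such as logarithms.
With `A = ∑ r, r P_r` and `B = ∑ s, s Q_s` one has `tr (f(A) g(B)) = ∑ r, ∑ s, f(r) g(s) tr (P_r Q_s)`;
so the trace of the expression with symbol `F(r, s)` is `∑ r, ∑ s, F(r, s) tr (P_r Q_s)`, computed
as the difference of the sums of the positive and of the negative parts. -/
def spectralTrace (A B : H →L[ℂ] H) (F : ℝ → ℝ → ℝ) : EReal :=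
  ((∑' r : ℝ, ∑' s : ℝ, overlap A B r s * ENNReal.ofReal (F r s) : ℝ≥0∞) : EReal) -
    ((∑' r : ℝ, ∑' s : ℝ, overlap A B r s * ENNReal.ofReal (-F r s) : ℝ≥0∞) : EReal)

open Classical in
/-- The von Neumann relative entropy `S(A, B) = tr (A log A - A log B)` of two states if
`ker B ⊆ ker A`, and `∞` otherwise. (In the first case `P_r Q_0 = 0` for `r ≠ 0`, so that the
value of the logarithm at `0` is immaterial. The sum of the negative parts is finite, since
`r log r - r log s ≥ r - s`.) -/
def relEntropy (A B : H →L[ℂ] H) : EReal :=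
  if B.ker ≤ A.ker then
    spectralTrace A B fun r s => r * Real.log r - r * Real.log s
  else ⊤

/-- `tr ((A - B) (log A - log B))` for two states with the same kernel (the value of the logarithm
at `0` is then immaterial); each term `(r - s) (log r - log s) tr (P_r Q_s)` is nonnegative. -/
def symTrace (A B : H →L[ℂ] H) : EReal :=
  spectralTrace A B fun r s => (r - s) * (Real.log r - Real.log s)

/-- The logarithm of a bounded self-adjoint operator by continuous functional calculus. It is used
only in finite dimension, where it is `∑ r, log r P_r` over the eigenvalues (zero on the kernel). -/
def logOp (A : H →L[ℂ] H) : H →L[ℂ] H :=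
  CFC.log A

end Trace

section Semigroups

variable {h : Type*} [NormedAddCommGroup h] [InnerProductSpace ℂ h] [CompleteSpace h]

/-- `σ'` is the image of `σ` under the pre-dual of `Φ`: it is trace class and
`tr (σ' y) = tr (σ Φ(y))` for all bounded `y`. -/
def IsPredualValue (Φ : (h →L[ℂ] h) → (h →L[ℂ] h)) (σ σ' : h →L[ℂ] h) : Prop :=
  IsTraceClass σ' ∧ ∀ y : h →L[ℂ] h, opTrace (σ' ∘L y) = opTrace (σ ∘L Φ y)

/-- `Φ` is normal (ultraweakly continuous): each normal functional `tr (σ ·)` is mapped to a normal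
functional `tr (σ Φ(·)) = tr (σ' ·)`. -/
def IsNormalMap (Φ : (h →L[ℂ] h) → (h →L[ℂ] h)) : Prop :=
  ∀ σ : h →L[ℂ] h, IsTraceClass σ → ∃ σ' : h →L[ℂ] h, IsPredualValue Φ σ σ'

open Classical in
/-- The pre-dual map `Φ_*` on trace class operators of a normal map `Φ`, determined by
`tr (Φ_*(σ) y) = tr (σ Φ(y))`. -/
def predual (Φ : (h →L[ℂ] h) → (h →L[ℂ] h)) (σ : h →L[ℂ] h) : h →L[ℂ] h :=
  if hσ : ∃ σ' : h →L[ℂ] h, IsPredualValue Φ σ σ' then hσ.choose else 0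

/-- A uniformly continuous quantum Markov semigroup on `B(h)`: a norm continuous semigroup of
normal, unital, completely positive maps. -/
structure UniformQMS (h : Type*) [NormedAddCommGroup h] [InnerProductSpace ℂ h]
    [CompleteSpace h] where
  map : ℝ≥0 → CompletelyPositiveMap (h →L[ℂ] h) (h →L[ℂ] h)
  map_zero : ∀ x, map 0 x = x
  map_add : ∀ s t x, map (s + t) x = map s (map t x)
  map_one : ∀ t, map t 1 = 1
  normal : ∀ t, IsNormalMap (map t)
  uniformly_continuous : ∀ ε : ℝ, 0 < ε → ∀ᶠ t in 𝓝 (0 : ℝ≥0), ∀ x, ‖map t x - x‖ ≤ ε * ‖x‖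

/-- The state `ρ` is invariant: `tr (ρ T_t(x)) = tr (ρ x)`. -/
def UniformQMS.IsInvariant (T : UniformQMS h) (ρ : h →L[ℂ] h) : Prop :=
  ∀ t x, opTrace (ρ ∘L T.map t x) = opTrace (ρ ∘L x)

/-- `ρ` is faithful: its kernel is trivial. -/
def IsFaithful (ρ : h →L[ℂ] h) : Prop :=
  ρ.ker = ⊥

/-- The reversing operation `Θ(x) = θ x* θ` given by an anti-unitary `θ`. -/
def reversing (θ : h ≃ₗᵢ⋆[ℂ] h) (x : h →L[ℂ] h) : h →L[ℂ] h :=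
  (θ : h →L⋆[ℂ] h).comp ((ContinuousLinearMap.adjoint x).comp (θ : h →L⋆[ℂ] h))

/-- `T'` is the `Θ`-KMS adjoint of `T` with respect to `ρ`:
`tr (ρ^½ Θ(x*) ρ^½ T_t(y)) = tr (ρ^½ Θ(T'_t(x*)) ρ^½ y)` for all bounded `x`, `y`. -/
def UniformQMS.IsThetaKMSAdjoint (T T' : UniformQMS h) (θ : h ≃ₗᵢ⋆[ℂ] h) (ρ : h →L[ℂ] h) :
    Prop :=
  ∀ (t : ℝ≥0) (x y : h →L[ℂ] h),
    opTrace (CFC.sqrt ρ ∘L reversing θ (ContinuousLinearMap.adjoint x) ∘L CFC.sqrt ρ ∘L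
        T.map t y) =
      opTrace (CFC.sqrt ρ ∘L reversing θ (T'.map t (ContinuousLinearMap.adjoint x)) ∘L
        CFC.sqrt ρ ∘L y)

end Semigroups

section Choi

variable {h : Type*} [NormedAddCommGroup h] [InnerProductSpace ℂ h] [CompleteSpace h]

/-- The Hilbert space tensor product `h ⊗ h`. -/
abbrev HTensor (h : Type*) [NormedAddCommGroup h] [InnerProductSpace ℂ h] : Type _ :=
  UniformSpace.Completion (h ⊗[ℂ] h)

/-- The simple tensor `u ⊗ v` in the Hilbert space `h ⊗ h`. -/
def htmul (u v : h) : HTensor h := ((u ⊗ₜ[ℂ] v : h ⊗[ℂ] h) : HTensor h)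

variable {ι : Type*}

/-- `J` is the bounded operator on `h ⊗ h` with matrix elements
`⟨e_k ⊗ e_l, J (e_k' ⊗ e_l')⟩ = ⟨e_l, Φ_*(|ρ^½ e_k⟩⟨ρ^½ e_k'|) e_l'⟩`, that is,
`J = (1 ⊗ Φ_*) (∑ i j, |e_i⟩⟨e_j| ⊗ |ρ^½ e_i⟩⟨ρ^½ e_j|)`. -/
def IsChoi (e : HilbertBasis ι ℂ h) (ρ : h →L[ℂ] h) (Φs : (h →L[ℂ] h) → (h →L[ℂ] h))
    (J : HTensor h →L[ℂ] HTensor h) : Prop :=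
  ∀ k l k' l' : ι,
    ⟪htmul (e k) (e l), J (htmul (e k') (e l'))⟫_ℂ =
      ⟪e l, Φs (InnerProductSpace.rankOne ℂ (CFC.sqrt ρ (e k)) (CFC.sqrt ρ (e k'))) (e l')⟫_ℂ

open Classical in
/-- The `ρ`-Choi-Jamiołkowski operator `J_ρ(Φ_*)` with respect to the orthonormal basis `e`
(unique by density of the span of the `e_k ⊗ e_l`; it exists for `Φ_*` bounded and completely
positive). -/
def choi (e : HilbertBasis ι ℂ h) (ρ : h →L[ℂ] h) (Φs : (h →L[ℂ] h) → (h →L[ℂ] h)) :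
    HTensor h →L[ℂ] HTensor h :=
  if hJ : ∃ J, IsChoi e ρ Φs J then hJ.choose else 0

/-- `J_ρ(T_{*t})`. -/
def UniformQMS.choi (T : UniformQMS h) (e : HilbertBasis ι ℂ h) (ρ : h →L[ℂ] h) (t : ℝ≥0) :
    HTensor h →L[ℂ] HTensor h :=
  QMS.choi e ρ (predual (T.map t))

end Choi

end

end QMS

/-!
Write `J` and `J'` for the `ρ`-Choi operators of `T_{*t}` and of its `Θ`-KMS adjoint.

**The two Choi operators are conjugate by an involution.** Testing the KMS duality on rank one
operators, and using that `θ` commutes with `ρ^½`, gives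
`⟨b, T_*(|ρ^½ θu⟩⟨ρ^½ θv|) a⟩ = ⟨u, T'_*(|ρ^½ θb⟩⟨ρ^½ θa|) v⟩` (`inner_predual_of_thetaKMS`).
In the orthonormal basis `e_k ⊗ θ e_l` of `h ⊗ h` this says that `J'` arises from `J` by swapping
the two indices, that is `J' = W J W` for a unitary with `W² = 1` (`exists_involution_choi`). Hence
`ker J' = W (ker J)`, and an inclusion between the kernels is an equality.

**The relative entropy is symmetrised.** Let `P_r` be the eigenprojections of `J`; those of `J'` are
`Q_s = W P_s W`, so `tr (P_r Q_s) = tr (P_r W P_s W)` is symmetric in `r` and `s` (`overlap_comm`).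
With `F(r, s) = r log r - r log s` one has `F(r, s) + F(s, r) = (r - s) (log r - log s)`, and
averaging the sum for `S(J, J')` with its transpose gives the formula
(`relEntropy_eq_half_symTrace`). The rearrangement of the possibly infinite sums is licit because
`F(r, s) ≥ -s` on the support of the overlaps and `∑ s tr (P_r Q_s) ≤ tr J' = 1`
(`tsum_overlap_mul_le_one`). In finite dimension both traces are evaluated in eigenbases of `J` and
`J'` (`symTrace_eq_opTrace`).

**The Choi operators exist and are states.** Complete positivity makes the matrix of `J` positive
semidefinite (`posSemidef_of_completelyPositive`); unitality makes its diagonal sum to `tr ρ = 1`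
(`hasSum_choi_diagonal`). A positive semidefinite matrix `M` with summable diagonal has square
summable entries, as `|M p q|² ≤ M p p * M q q`, and so is the matrix of a bounded positive operator
(`exists_nonneg_of_posSemidef`).
-/

namespace QMS

noncomputable section

/-! ### Hilbert–Schmidt norms and traces of positive operators -/

section HilbertSchmidt

variable {H : Type*} [NormedAddCommGroup H] [InnerProductSpace ℂ H] [CompleteSpace H]
  {κ κ' : Type*}

/-- The squared Hilbert–Schmidt norm `∑ i, ‖S b_i‖²`, computed in the orthonormal basis `b`. -/
def hsSq (b : HilbertBasis κ ℂ H) (S : H →L[ℂ] H) : ℝ≥0∞ :=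
  ∑' i, ENNReal.ofReal (‖S (b i)‖ ^ 2)

omit [CompleteSpace H] in
lemma inner_self_eq_ofReal (x : H) : ⟪x, x⟫_ℂ = ((‖x‖ : ℝ) : ℂ) ^ 2 :=
  inner_self_eq_norm_sq_to_K x

omit [CompleteSpace H] in
lemma hasSum_norm_inner_sq (b : HilbertBasis κ ℂ H) (x : H) :
    HasSum (fun i => ‖⟪b i, x⟫_ℂ‖ ^ 2) (‖x‖ ^ 2) := by
  have h1 := Complex.hasSum_re (b.hasSum_inner_mul_inner x x)
  convert h1 using 1
  · funext i
    rw [← inner_conj_symm x (b i), ← Complex.normSq_eq_conj_mul_self, Complex.normSq_eq_norm_sq,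
      Complex.ofReal_re]
  · rw [inner_self_eq_norm_sq_to_K]
    norm_cast

omit [CompleteSpace H] in
lemma ofReal_norm_sq_eq_tsum (b : HilbertBasis κ ℂ H) (x : H) :
    ENNReal.ofReal (‖x‖ ^ 2) = ∑' i, ENNReal.ofReal (‖⟪b i, x⟫_ℂ‖ ^ 2) := by
  rw [← (hasSum_norm_inner_sq b x).tsum_eq,
    ENNReal.ofReal_tsum_of_nonneg (fun _ => by positivity) (hasSum_norm_inner_sq b x).summable]

/-- The Hilbert–Schmidt norm is invariant under adjoints; since the two bases are arbitrary, this
also contains its independence of the basis. -/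
lemma hsSq_adjoint (b : HilbertBasis κ ℂ H) (b' : HilbertBasis κ' ℂ H) (S : H →L[ℂ] H) :
    hsSq b' (ContinuousLinearMap.adjoint S) = hsSq b S := by
  unfold hsSq
  simp_rw [ofReal_norm_sq_eq_tsum b (ContinuousLinearMap.adjoint S _),
    ofReal_norm_sq_eq_tsum b' (S _)]
  rw [ENNReal.tsum_comm]
  refine tsum_congr fun i => tsum_congr fun j => ?_
  rw [ContinuousLinearMap.adjoint_inner_right, ← norm_inner_symm]

lemma hsSq_eq_hsSq (b : HilbertBasis κ ℂ H) (b' : HilbertBasis κ' ℂ H) (S : H →L[ℂ] H) :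
    hsSq b S = hsSq b' S := by
  rw [← hsSq_adjoint b b, hsSq_adjoint b' b]

lemma inner_apply_self_eq_norm_sqrt_sq {A : H →L[ℂ] H} (hA : 0 ≤ A) (x : H) :
    ⟪x, A x⟫_ℂ = ((‖CFC.sqrt A x‖ ^ 2 : ℝ) : ℂ) := by
  have hs : IsSelfAdjoint (CFC.sqrt A) := (CFC.sqrt_nonneg A).isSelfAdjoint
  conv_lhs => rw [← CFC.sqrt_mul_sqrt_self A hA]
  change ⟪x, CFC.sqrt A (CFC.sqrt A x)⟫_ℂ = _
  rw [← ContinuousLinearMap.adjoint_inner_left,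
    hs.adjoint_eq, inner_self_eq_norm_sq_to_K]
  norm_cast

lemma summable_inner_apply_self_iff {A : H →L[ℂ] H} (hA : 0 ≤ A) (b : HilbertBasis κ ℂ H) :
    (Summable fun i => ⟪b i, A (b i)⟫_ℂ) ↔ hsSq b (CFC.sqrt A) ≠ ⊤ := by
  simp_rw [inner_apply_self_eq_norm_sqrt_sq hA]
  rw [Complex.summable_ofReal, hsSq]
  exact ⟨fun hs => hs.tsum_ofReal_ne_top, fun hs => by
    simpa using ENNReal.summable_toReal hs⟩

lemma tsum_inner_apply_self {A : H →L[ℂ] H} (hA : 0 ≤ A) (b : HilbertBasis κ ℂ H) :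
    ∑' i, ⟪b i, A (b i)⟫_ℂ = ((hsSq b (CFC.sqrt A)).toReal : ℂ) := by
  simp_rw [inner_apply_self_eq_norm_sqrt_sq hA]
  rw [← Complex.ofReal_tsum, hsSq, ENNReal.tsum_toReal_eq fun _ => ENNReal.ofReal_ne_top]
  simp

/-- The trace of a positive operator does not depend on the orthonormal basis. -/
lemma hasSum_inner_apply_self {A : H →L[ℂ] H} (hA : 0 ≤ A) (b : HilbertBasis κ ℂ H)
    (b' : HilbertBasis κ' ℂ H) {c : ℂ} (hc : HasSum (fun i => ⟪b i, A (b i)⟫_ℂ) c) :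
    HasSum (fun i => ⟪b' i, A (b' i)⟫_ℂ) c := by
  have h1 := hc.summable
  rw [summable_inner_apply_self_iff hA, hsSq_eq_hsSq b b',
    ← summable_inner_apply_self_iff hA] at h1
  rw [← hc.tsum_eq, tsum_inner_apply_self hA, hsSq_eq_hsSq b b', ← tsum_inner_apply_self hA]
  exact h1.hasSum

lemma IsTraceClass.hasSum {A : H →L[ℂ] H} (hA : 0 ≤ A) (hT : IsTraceClass A)
    (b : HilbertBasis κ ℂ H) : HasSum (fun i => ⟪b i, A (b i)⟫_ℂ) (opTrace A) := by
  refine hasSum_inner_apply_self hA (onb H) b ?_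
  rw [IsTraceClass, CFC.abs_of_nonneg A hA] at hT
  exact hT.hasSum

lemma isState_of_hasSum {A : H →L[ℂ] H} (hA : 0 ≤ A) (b : HilbertBasis κ ℂ H)
    (hc : HasSum (fun i => ⟪b i, A (b i)⟫_ℂ) 1) : IsState A := by
  have h1 := hasSum_inner_apply_self hA b (onb H) hc
  exact ⟨hA, by rw [IsTraceClass, CFC.abs_of_nonneg A hA]; exact h1.summable, h1.tsum_eq⟩

end HilbertSchmidt

/-! ### Rank one operators -/

section RankOne

variable {H : Type*} [NormedAddCommGroup H] [InnerProductSpace ℂ H] [CompleteSpace H]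

open InnerProductSpace (rankOne)

/-- The inverse of `‖v‖` is the junk value `0` for `v = 0`, when both sides vanish. -/
lemma abs_rankOne (u v : H) :
    CFC.abs (rankOne ℂ u v) = ((‖u‖ * ‖v‖⁻¹ : ℝ) : ℂ) • rankOne ℂ v v := by
  refine CFC.sqrt_unique ?_ ?_
  · rw [ContinuousLinearMap.star_eq_adjoint, InnerProductSpace.adjoint_rankOne]
    ext x
    change ((‖u‖ * ‖v‖⁻¹ : ℝ) : ℂ) • rankOne ℂ v v (((‖u‖ * ‖v‖⁻¹ : ℝ) : ℂ) • rankOne ℂ v v x) =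
      rankOne ℂ v u (rankOne ℂ u v x)
    simp only [InnerProductSpace.rankOne_apply, smul_smul, map_smul, inner_self_eq_ofReal]
    congr 1
    rcases eq_or_ne v 0 with rfl | hv
    · simp
    · have : (‖v‖ : ℂ) ≠ 0 := by simpa using hv
      push_cast
      field_simp
  · rw [ContinuousLinearMap.nonneg_iff_isPositive]
    exact (InnerProductSpace.isPositive_rankOne_self v).smul_of_nonneg
      (by rw [Complex.zero_le_real]; positivity)

lemma isTraceClass_rankOne (u v : H) : IsTraceClass (rankOne ℂ u v) := by
  rw [IsTraceClass, abs_rankOne]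
  refine (((onb H).summable_inner_mul_inner v v).mul_left ((‖u‖ * ‖v‖⁻¹ : ℝ) : ℂ)).congr
    fun i => ?_
  simp

lemma opTrace_rankOne (u v : H) : opTrace (rankOne ℂ u v) = ⟪v, u⟫_ℂ := by
  rw [← (onb H).tsum_inner_mul_inner, opTrace]
  simp

lemma opTrace_rankOne_comp (u v : H) (X : H →L[ℂ] H) :
    opTrace (rankOne ℂ u v ∘L X) = ⟪v, X u⟫_ℂ := by
  rw [InnerProductSpace.rankOne_comp, opTrace_rankOne, ContinuousLinearMap.adjoint_inner_left]

lemma opTrace_comp_rankOne (u v : H) (X : H →L[ℂ] H) :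
    opTrace (X ∘L rankOne ℂ u v) = ⟪v, X u⟫_ℂ := by
  rw [InnerProductSpace.comp_rankOne, opTrace_rankOne]

end RankOne

/-! ### Operators given by their matrix in an orthonormal basis -/

section Kernel

open scoped ComplexOrder

variable {H : Type*} [NormedAddCommGroup H] [InnerProductSpace ℂ H] [CompleteSpace H]
  {κ : Type*}

/-- Prescribing square summable images of the vectors of an orthonormal basis defines a bounded
(indeed Hilbert–Schmidt) operator. -/
lemma exists_clm_apply_basis (f : HilbertBasis κ ℂ H) (g : κ → H)
    (hg : Summable fun q => ‖g q‖ ^ 2) : ∃ J : H →L[ℂ] H, ∀ q, J (f q) = g q := by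
  have hconj : Real.HolderConjugate 2 2 := Real.HolderConjugate.two_two
  have key (x : H) := Real.summable_and_inner_le_Lp_mul_Lq_tsum_of_nonneg
    (f := fun q => ‖⟪f q, x⟫_ℂ‖) (g := fun q => ‖g q‖) hconj (fun _ => norm_nonneg _)
    (fun _ => norm_nonneg _) (by simpa using (hasSum_norm_inner_sq f x).summable) (by simpa using hg)
  have hn (x : H) : Summable fun q => ‖⟪f q, x⟫_ℂ • g q‖ := by
    simpa only [norm_smul] using (key x).1
  have hs (x : H) : Summable fun q => ⟪f q, x⟫_ℂ • g q := (hn x).of_norm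
  let L : H →ₗ[ℂ] H :=
    { toFun := fun x => ∑' q, ⟪f q, x⟫_ℂ • g q
      map_add' := fun x y => by
        rw [← (hs x).tsum_add (hs y)]
        simp only [inner_add_right, add_smul]
      map_smul' := fun c x => by
        rw [RingHom.id_apply, ← tsum_const_smul'']
        simp only [inner_smul_right, smul_smul] }
  refine ⟨L.mkContinuous ((∑' q, ‖g q‖ ^ (2 : ℝ)) ^ (1 / 2 : ℝ)) fun x => ?_, fun q => ?_⟩
  · refine (norm_tsum_le_tsum_norm (hn x)).trans ?_
    simp only [norm_smul]
    refine (key x).2.trans (le_of_eq ?_)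
    rw [mul_comm]
    congr 1
    simp only [Real.rpow_two]
    rw [(hasSum_norm_inner_sq f x).tsum_eq, ← Real.sqrt_eq_rpow, Real.sqrt_sq (norm_nonneg x)]
  · change ∑' p, ⟪f p, f q⟫_ℂ • g p = g q
    classical
    rw [tsum_eq_single q]
    · rw [inner_self_eq_norm_sq_to_K, f.orthonormal.1 q]
      simp
    · intro p hp
      rw [f.orthonormal.2 hp, zero_smul]

omit [CompleteSpace H] in
lemma ext_inner_basis (f : HilbertBasis κ ℂ H) {x y : H} (hxy : ∀ p, ⟪f p, x⟫_ℂ = ⟪f p, y⟫_ℂ) :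
    x = y := by
  apply f.repr.injective
  ext p
  simpa [HilbertBasis.repr_apply_apply] using hxy p

omit [CompleteSpace H] in
lemma ext_apply_basis {E : Type*} [NormedAddCommGroup E] [NormedSpace ℂ E]
    (f : HilbertBasis κ ℂ H) {A B : H →L[ℂ] E} (hAB : ∀ p, A (f p) = B (f p)) : A = B :=
  ContinuousLinearMap.ext_on
    (by rw [Submodule.dense_iff_topologicalClosure_eq_top]; exact f.dense_span)
    (by rintro _ ⟨p, rfl⟩; exact hAB p)

omit [CompleteSpace H] in
lemma ext_inner_apply_basis (f : HilbertBasis κ ℂ H) {A B : H →L[ℂ] H}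
    (hAB : ∀ p q, ⟪f p, A (f q)⟫_ℂ = ⟪f p, B (f q)⟫_ℂ) : A = B :=
  ext_apply_basis f fun q => ext_inner_basis f fun p => hAB p q

lemma nonneg_of_posSemidef (f : HilbertBasis κ ℂ H) {J : H →L[ℂ] H}
    (hJ : Matrix.PosSemidef (Matrix.of fun p q => ⟪f p, J (f q)⟫_ℂ)) : 0 ≤ J := by
  rw [ContinuousLinearMap.nonneg_iff_isPositive, ContinuousLinearMap.isPositive_def']
  refine ⟨?_, fun x => ?_⟩
  · rw [ContinuousLinearMap.isSelfAdjoint_iff']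
    refine ext_inner_apply_basis f fun p q => ?_
    have h1 : starRingEnd ℂ ⟪f q, J (f p)⟫_ℂ = ⟪f p, J (f q)⟫_ℂ := hJ.1.apply p q
    rw [ContinuousLinearMap.adjoint_inner_right, ← inner_conj_symm, h1]
  · have hd : Dense (Submodule.span ℂ (Set.range f) : Set H) := by
      rw [Submodule.dense_iff_topologicalClosure_eq_top]
      exact f.dense_span
    refine hd.induction ?_ (isClosed_le continuous_const ?_) x
    · intro y hy
      obtain ⟨c, rfl⟩ := (Finsupp.mem_span_range_iff_exists_finsupp).1 hy
      have h1 := hJ.2 c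
      have h2 : ⟪(c.sum fun i a => a • f i), J (c.sum fun i a => a • f i)⟫_ℂ =
          c.sum fun i xi => c.sum fun j xj => star xi *
            (Matrix.of fun p q => ⟪f p, J (f q)⟫_ℂ) i j * xj := by
        simp only [Finsupp.sum, map_sum, map_smul, sum_inner, inner_sum, inner_smul_left,
          inner_smul_right, Matrix.of_apply, starRingEnd_apply, Finset.mul_sum]
        rw [Finset.sum_comm]
        refine Finset.sum_congr rfl fun i _ => Finset.sum_congr rfl fun j _ => ?_
        ring
      rw [← h2] at h1
      rw [ContinuousLinearMap.reApplyInnerSelf_apply, inner_re_symm]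
      exact (Complex.le_def.1 h1).1
    · exact ContinuousLinearMap.reApplyInnerSelf_continuous _

/-- The determinants of the `2 × 2` principal submatrices are nonnegative. -/
lemma norm_sq_le_of_posSemidef {M : Matrix κ κ ℂ} (hM : M.PosSemidef) (p q : κ) :
    ‖M p q‖ ^ 2 ≤ (M p p).re * (M q q).re := by
  have h1 := (hM.submatrix ![p, q]).det_nonneg
  rw [Matrix.det_fin_two] at h1
  simp only [Matrix.submatrix_apply, Matrix.cons_val_zero, Matrix.cons_val_one] at h1
  have h2 := hM.1.apply q p
  have hp := Complex.le_def.1 (hM.diag_nonneg (i := p))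
  have hq := Complex.le_def.1 (hM.diag_nonneg (i := q))
  rw [← h2, ← starRingEnd_apply, Complex.mul_conj, Complex.normSq_eq_norm_sq] at h1
  have h3 := (Complex.le_def.1 h1).1
  simp only [Complex.sub_re, Complex.mul_re, Complex.ofReal_re, Complex.zero_re,
    ← hp.2, Complex.zero_im] at h3
  linarith

/-- A positive semidefinite matrix with summable diagonal is the matrix of a positive bounded
operator: since `|M p q|² ≤ M p p * M q q`, its entries are square summable. -/
lemma exists_nonneg_of_posSemidef (f : HilbertBasis κ ℂ H) {M : Matrix κ κ ℂ}
    (hM : M.PosSemidef) (hs : Summable fun p => (M p p).re) :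
    ∃ J : H →L[ℂ] H, 0 ≤ J ∧ ∀ p q, ⟪f p, J (f q)⟫_ℂ = M p q := by
  have hsq (q : κ) : Summable fun p => ‖M p q‖ ^ 2 :=
    (hs.mul_right (M q q).re).of_nonneg_of_le (fun _ => by positivity)
      fun p => norm_sq_le_of_posSemidef hM p q
  have hmem (q : κ) : Memℓp (fun p => M p q) 2 := by
    rw [memℓp_gen_iff (by norm_num)]
    simpa using hsq q
  let g (q : κ) : H := f.repr.symm ⟨fun p => M p q, hmem q⟩
  have hg (p q : κ) : ⟪f p, g q⟫_ℂ = M p q := by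
    rw [← f.repr_apply_apply]
    simp [g]
  have hg2 (q : κ) : ‖g q‖ ^ 2 ≤ (∑' p, (M p p).re) * (M q q).re := by
    rw [← (hasSum_norm_inner_sq f (g q)).tsum_eq, ← tsum_mul_right]
    simp only [hg]
    exact (hsq q).tsum_le_tsum (fun p => norm_sq_le_of_posSemidef hM p q) (hs.mul_right _)
  obtain ⟨J, hJ⟩ := exists_clm_apply_basis f g
    ((hs.mul_left _).of_nonneg_of_le (fun _ => by positivity) hg2)
  have hJM (p q : κ) : ⟪f p, J (f q)⟫_ℂ = M p q := by rw [hJ, hg]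
  refine ⟨J, nonneg_of_posSemidef f ?_, hJM⟩
  simp only [hJM]
  exact hM

end Kernel

/-! ### Pre-dual maps on rank one operators -/

section Predual

variable {h : Type*} [NormedAddCommGroup h] [InnerProductSpace ℂ h] [CompleteSpace h]

open InnerProductSpace (rankOne)

lemma IsNormalMap.isPredualValue_rankOne {Φ : (h →L[ℂ] h) → (h →L[ℂ] h)} (hΦ : IsNormalMap Φ)
    (u v : h) : IsPredualValue Φ (rankOne ℂ u v) (predual Φ (rankOne ℂ u v)) := by
  have hex := hΦ _ (isTraceClass_rankOne u v)
  rw [predual, dif_pos hex]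
  exact hex.choose_spec

lemma IsNormalMap.inner_predual_rankOne {Φ : (h →L[ℂ] h) → (h →L[ℂ] h)} (hΦ : IsNormalMap Φ)
    (u v a b : h) :
    ⟪b, predual Φ (rankOne ℂ u v) a⟫_ℂ = ⟪v, Φ (rankOne ℂ a b) u⟫_ℂ := by
  rw [← opTrace_comp_rankOne, (hΦ.isPredualValue_rankOne u v).2, opTrace_rankOne_comp]

lemma IsNormalMap.opTrace_predual_rankOne {Φ : (h →L[ℂ] h) → (h →L[ℂ] h)} (hΦ : IsNormalMap Φ)
    (hΦ1 : Φ 1 = 1) (u v : h) : opTrace (predual Φ (rankOne ℂ u v)) = ⟪v, u⟫_ℂ := by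
  have h1 := (hΦ.isPredualValue_rankOne u v).2 1
  rw [hΦ1, opTrace_rankOne_comp] at h1
  exact h1

end Predual

/-! ### Complete positivity in terms of matrix elements -/

section CompletelyPositive

open scoped ComplexOrder CStarAlgebra

open InnerProductSpace (rankOne)

variable {h : Type*} [NormedAddCommGroup h] [InnerProductSpace ℂ h] [CompleteSpace h]

lemma inner_star_mul_self_apply {n : Type*} [Fintype n] (Z : CStarMatrix n n (h →L[ℂ] h))
    (j i : n) (x y : h) : ⟪x, (star Z * Z) j i y⟫_ℂ = ∑ r, ⟪Z r j x, Z r i y⟫_ℂ := by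
  have h1 : (star Z * Z) j i = ∑ r, (ContinuousLinearMap.adjoint (Z r j)) ∘L Z r i := by
    rw [CStarMatrix.mul_apply]
    rfl
  rw [h1, sum_apply, inner_sum]
  refine Finset.sum_congr rfl fun r _ => ?_
  rw [ContinuousLinearMap.comp_apply, ContinuousLinearMap.adjoint_inner_right]

lemma sum_inner_cstarMatrix_nonneg {n : Type*} [Fintype n] {N : CStarMatrix n n (h →L[ℂ] h)}
    (hN : 0 ≤ N) (η : n → h) : 0 ≤ ∑ i, ∑ j, ⟪η j, N j i (η i)⟫_ℂ := by
  rw [StarOrderedRing.nonneg_iff] at hN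
  induction hN using AddSubmonoid.closure_induction with
  | zero => simp
  | add M N _ _ hM hN =>
    simp only [CStarMatrix.add_apply, add_apply, inner_add_right, Finset.sum_add_distrib]
    exact add_nonneg hM hN
  | mem N hN =>
    obtain ⟨Z, rfl⟩ := hN
    have hentry (i j : n) := inner_star_mul_self_apply Z j i (η j) (η i)
    have h1 : ∑ i, ∑ j, ⟪η j, (star Z * Z) j i (η i)⟫_ℂ =
        ∑ r, ⟪∑ j, Z r j (η j), ∑ i, Z r i (η i)⟫_ℂ := by
      simp only [hentry, inner_sum, sum_inner]
      rw [Finset.sum_comm_cycle]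
    change 0 ≤ ∑ i, ∑ j, ⟪η j, (star Z * Z) j i (η i)⟫_ℂ
    rw [h1]
    refine Finset.sum_nonneg fun r _ => ?_
    rw [inner_self_eq_ofReal, ← Complex.ofReal_pow, Complex.zero_le_real]
    positivity

/-- The block matrix `(|a_q⟩⟨a_p|)_{q,p}` equals `Y* Y` for a matrix `Y` with one nonzero row
`(|w⟩⟨a_p|)_p`, `w` a unit vector. -/
lemma rankOne_cstarMatrix_nonneg {n : Type*} [Fintype n] (a : n → h) :
    0 ≤ CStarMatrix.ofMatrix (Matrix.of fun q p => rankOne ℂ (a q) (a p)) := by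
  classical
  rcases isEmpty_or_nonempty n with hn | ⟨⟨r₀⟩⟩
  · refine le_of_eq ?_
    ext i
    exact hn.elim i
  rcases subsingleton_or_nontrivial h with hh | hh
  · refine le_of_eq ?_
    ext i j x
    exact Subsingleton.elim _ _
  obtain ⟨w, hw⟩ := exists_norm_eq h zero_le_one
  let Y : CStarMatrix n n (h →L[ℂ] h) :=
    CStarMatrix.ofMatrix (Matrix.of fun r p => if r = r₀ then rankOne ℂ w (a p) else 0)
  have hY : CStarMatrix.ofMatrix (Matrix.of fun q p => rankOne ℂ (a q) (a p)) = star Y * Y := by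
    ext1 q p
    rw [CStarMatrix.mul_apply, Finset.sum_eq_single r₀]
    · rw [CStarMatrix.star_apply]
      simp only [Y, CStarMatrix.ofMatrix_apply, Matrix.of_apply, if_true]
      rw [ContinuousLinearMap.star_eq_adjoint, InnerProductSpace.adjoint_rankOne]
      ext x
      change _ = rankOne ℂ (a q) w (rankOne ℂ w (a p) x)
      simp [hw]
    · intro r _ hr
      simp [Y, hr]
    · simp
  rw [hY]
  exact star_mul_self_nonneg Y

/-- The quadratic form of this matrix at `x` is the quadratic form of the positive block matrix
`(Φ(|a_q⟩⟨a_p|))_{q,p}` at the vectors `conj (x p) • ξ p`. By `IsNormalMap.inner_predual_rankOne` the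
matrix of the Choi operator has this form. -/
lemma posSemidef_of_completelyPositive (Φ : CompletelyPositiveMap (h →L[ℂ] h) (h →L[ℂ] h))
    {κ : Type*} (a ξ : κ → h) :
    Matrix.PosSemidef (Matrix.of fun p q => ⟪ξ q, Φ (rankOne ℂ (a q) (a p)) (ξ p)⟫_ℂ) := by
  refine ⟨?_, fun x => ?_⟩
  · ext p q
    have hN := CompletelyPositiveMap.map_cstarMatrix_nonneg Φ _
      (rankOne_cstarMatrix_nonneg (a ∘ ![p, q]))
    have h1 := CStarMatrix.star_apply_of_isSelfAdjoint hN.isSelfAdjoint (i := 0) (j := 1)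
    simp only [CStarMatrix.map_apply, CStarMatrix.ofMatrix_apply, Matrix.of_apply,
      Function.comp_apply, Matrix.cons_val_zero, Matrix.cons_val_one] at h1
    change starRingEnd ℂ ⟪ξ p, Φ (rankOne ℂ (a p) (a q)) (ξ q)⟫_ℂ =
      ⟪ξ q, Φ (rankOne ℂ (a q) (a p)) (ξ p)⟫_ℂ
    rw [inner_conj_symm, ← h1, ContinuousLinearMap.star_eq_adjoint,
      ContinuousLinearMap.adjoint_inner_right]
  · have hN := CompletelyPositiveMap.map_cstarMatrix_nonneg Φ _
      (rankOne_cstarMatrix_nonneg fun i : x.support => a i)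
    have h1 := sum_inner_cstarMatrix_nonneg hN fun i : x.support => star (x i) • ξ i
    simp only [CStarMatrix.map_apply, CStarMatrix.ofMatrix_apply, Matrix.of_apply, map_smul,
      inner_smul_left, inner_smul_right] at h1
    rw [Finsupp.sum, ← Finset.sum_coe_sort]
    simp only [Finsupp.sum]
    convert h1 using 2 with i
    rw [← Finset.sum_coe_sort]
    refine Finset.sum_congr rfl fun j _ => ?_
    simp only [Matrix.of_apply, starRingEnd_apply, star_star]
    ring

end CompletelyPositive

/-! ### The Hilbert space tensor product -/

section Tensor

variable {h : Type*} [NormedAddCommGroup h] [InnerProductSpace ℂ h] [CompleteSpace h]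
  {ι ι' : Type*}

omit [CompleteSpace h] in
lemma inner_htmul (u v u' v' : h) :
    ⟪htmul u v, htmul u' v'⟫_ℂ = ⟪u, u'⟫_ℂ * ⟪v, v'⟫_ℂ := by
  rw [htmul, htmul, UniformSpace.Completion.inner_coe, TensorProduct.inner_tmul]

/-- `v ↦ u ⊗ v` as a bounded operator. -/
def htmulL (u : h) : h →L[ℂ] HTensor h :=
  UniformSpace.Completion.toComplL.comp (TensorProduct.mkL ℂ h h u)

/-- `u ↦ u ⊗ v` as a bounded operator. -/
def htmulR (v : h) : h →L[ℂ] HTensor h :=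
  UniformSpace.Completion.toComplL.comp ((TensorProduct.mkL ℂ h h).flip v)

omit [CompleteSpace h] in
/-- The products of the vectors of two orthonormal bases of `h` form an orthonormal basis of
`h ⊗ h`. -/
lemma exists_htmul_basis (e : HilbertBasis ι ℂ h) (e' : HilbertBasis ι' ℂ h) :
    ∃ f : HilbertBasis (ι × ι') ℂ (HTensor h), ∀ p, f p = htmul (e p.1) (e' p.2) := by
  classical
  have hon : Orthonormal ℂ fun p : ι × ι' => htmul (e p.1) (e' p.2) := by
    rw [orthonormal_iff_ite]
    rintro ⟨i, j⟩ ⟨i', j'⟩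
    rw [inner_htmul, orthonormal_iff_ite.1 e.orthonormal, orthonormal_iff_ite.1 e'.orthonormal]
    by_cases h1 : i = i' <;> by_cases h2 : j = j' <;> simp [h1, h2]
  refine ⟨HilbertBasis.mkOfOrthogonalEqBot hon ?_, fun p => ?_⟩
  · rw [Submodule.eq_bot_iff]
    intro x hx
    have h0 (i : ι) (j : ι') : ⟪x, htmul (e i) (e' j)⟫_ℂ = 0 :=
      (Submodule.mem_orthogonal' _ _).1 hx _ (Submodule.subset_span ⟨(i, j), rfl⟩)
    have h1 (u : h) (j : ι') : ⟪x, htmul u (e' j)⟫_ℂ = 0 :=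
      DFunLike.congr_fun (ext_apply_basis e (A := (innerSL ℂ x).comp (htmulR (e' j))) (B := 0)
        fun i => h0 i j) u
    have h2 (u v : h) : ⟪x, htmul u v⟫_ℂ = 0 :=
      DFunLike.congr_fun (ext_apply_basis e' (A := (innerSL ℂ x).comp (htmulL u)) (B := 0)
        fun j => h1 u j) v
    have h3 (y : HTensor h) : ⟪x, y⟫_ℂ = 0 := by
      induction y using UniformSpace.Completion.induction_on with
      | hp => exact isClosed_eq (by fun_prop) continuous_const
      | ih y =>
        induction y using TensorProduct.induction_on with
        | zero => rw [UniformSpace.Completion.coe_zero, inner_zero_right]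
        | tmul u v => exact h2 u v
        | add y z hy hz => rw [UniformSpace.Completion.coe_add, inner_add_right, hy, hz, add_zero]
    exact inner_self_eq_zero.1 (h3 x)
  · rw [HilbertBasis.coe_mkOfOrthogonalEqBot]

end Tensor

/-! ### Existence and trace of the Choi operator -/

section ChoiState

open InnerProductSpace (rankOne)

variable {h : Type*} [NormedAddCommGroup h] [InnerProductSpace ℂ h] [CompleteSpace h]
  {ι : Type*}

lemma predual_rankOne_self_nonneg {Φ : CompletelyPositiveMap (h →L[ℂ] h) (h →L[ℂ] h)}
    (hΦ : IsNormalMap Φ) (u : h) : 0 ≤ predual Φ (rankOne ℂ u u) := by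
  refine nonneg_of_posSemidef (onb h) ?_
  simp only [hΦ.inner_predual_rankOne]
  exact posSemidef_of_completelyPositive Φ (onb h) fun _ => u

lemma hasSum_inner_predual_rankOne_self {Φ : CompletelyPositiveMap (h →L[ℂ] h) (h →L[ℂ] h)}
    (hΦ : IsNormalMap Φ) (hΦ1 : Φ 1 = 1) (e : HilbertBasis ι ℂ h) (u : h) :
    HasSum (fun l => ⟪e l, predual Φ (rankOne ℂ u u) (e l)⟫_ℂ) (⟪u, u⟫_ℂ) := by
  rw [← hΦ.opTrace_predual_rankOne hΦ1]
  exact (hΦ.isPredualValue_rankOne u u).1.hasSum (predual_rankOne_self_nonneg hΦ u) e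

/-- The matrix of `J_ρ(Φ_*)` has trace one: summing over the second index gives
`tr Φ_*(|ρ^½ e_k⟩⟨ρ^½ e_k|) = ‖ρ^½ e_k‖²` as `Φ` is unital, and these numbers sum to `tr ρ`. -/
lemma hasSum_choi_diagonal {Φ : CompletelyPositiveMap (h →L[ℂ] h) (h →L[ℂ] h)}
    (hΦ : IsNormalMap Φ) (hΦ1 : Φ 1 = 1) (e : HilbertBasis ι ℂ h) {ρ : h →L[ℂ] h}
    (hρ : IsState ρ) :
    HasSum (fun p : ι × ι => ⟪e p.2,
      predual Φ (rankOne ℂ (CFC.sqrt ρ (e p.1)) (CFC.sqrt ρ (e p.1))) (e p.2)⟫_ℂ) 1 := by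
  set D := fun k => predual Φ (rankOne ℂ (CFC.sqrt ρ (e k)) (CFC.sqrt ρ (e k))) with hD
  have hDsq (k l : ι) : ⟪e l, D k (e l)⟫_ℂ = ((‖CFC.sqrt (D k) (e l)‖ ^ 2 : ℝ) : ℂ) :=
    inner_apply_self_eq_norm_sqrt_sq (predual_rankOne_self_nonneg hΦ _) _
  have h1 (k : ι) : HasSum (fun l => ‖CFC.sqrt (D k) (e l)‖ ^ 2) (‖CFC.sqrt ρ (e k)‖ ^ 2) := by
    have := hasSum_inner_predual_rankOne_self hΦ hΦ1 e (CFC.sqrt ρ (e k))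
    change HasSum (fun l => ⟪e l, D k (e l)⟫_ℂ) _ at this
    simp only [hDsq] at this
    rw [inner_self_eq_ofReal, ← Complex.ofReal_pow] at this
    exact Complex.hasSum_ofReal.1 this
  have h2 : HasSum (fun k => ‖CFC.sqrt ρ (e k)‖ ^ 2) 1 := by
    have := hρ.2.1.hasSum hρ.1 e
    rw [hρ.2.2] at this
    simp only [inner_apply_self_eq_norm_sqrt_sq hρ.1] at this
    exact Complex.hasSum_ofReal.1 (by simpa using this)
  have h3 : Summable fun p : ι × ι => ‖CFC.sqrt (D p.1) (e p.2)‖ ^ 2 := by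
    rw [summable_prod_of_nonneg fun _ => by positivity]
    refine ⟨fun k => (h1 k).summable, ?_⟩
    simp only [(h1 _).tsum_eq]
    exact h2.summable
  have h4 : HasSum (fun p : ι × ι => ‖CFC.sqrt (D p.1) (e p.2)‖ ^ 2) 1 := by
    have := h3.hasSum
    rwa [(this.prod_fiberwise h1).unique h2] at this
  have h5 := Complex.hasSum_ofReal.2 h4
  simp only [← hDsq] at h5
  simpa using h5

lemma IsChoi.unique {e : HilbertBasis ι ℂ h} {ρ : h →L[ℂ] h}
    {Φs : (h →L[ℂ] h) → (h →L[ℂ] h)} {J J' : HTensor h →L[ℂ] HTensor h}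
    (hJ : IsChoi e ρ Φs J) (hJ' : IsChoi e ρ Φs J') : J = J' := by
  obtain ⟨f, hf⟩ := exists_htmul_basis e e
  refine ext_inner_apply_basis f fun p q => ?_
  rw [hf, hf, hJ, hJ']

lemma isChoi_choi_and_isState {Φ : CompletelyPositiveMap (h →L[ℂ] h) (h →L[ℂ] h)}
    (hΦ : IsNormalMap Φ) (hΦ1 : Φ 1 = 1) (e : HilbertBasis ι ℂ h) {ρ : h →L[ℂ] h}
    (hρ : IsState ρ) :
    IsChoi e ρ (predual Φ) (choi e ρ (predual Φ)) ∧ IsState (choi e ρ (predual Φ)) := by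
  obtain ⟨f, hf⟩ := exists_htmul_basis e e
  have hM := posSemidef_of_completelyPositive Φ (fun p : ι × ι => e p.2)
    (fun p => CFC.sqrt ρ (e p.1))
  have hd := hasSum_choi_diagonal hΦ hΦ1 e hρ
  simp only [hΦ.inner_predual_rankOne] at hd
  obtain ⟨J, hJ0, hJM⟩ := exists_nonneg_of_posSemidef f hM (Complex.hasSum_re hd).summable
  have hJ : IsChoi e ρ (predual Φ) J := fun k l k' l' => by
    have := hJM (k, l) (k', l')
    rw [hf, hf] at this
    rw [this, hΦ.inner_predual_rankOne]
    rfl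
  have hex : ∃ J, IsChoi e ρ (predual Φ) J := ⟨J, hJ⟩
  have hc : IsChoi e ρ (predual Φ) (choi e ρ (predual Φ)) := by
    rw [choi, dif_pos hex]
    exact hex.choose_spec
  refine ⟨hc, ?_⟩
  rw [hc.unique hJ]
  refine isState_of_hasSum hJ0 f ?_
  simp only [hJM]
  exact hd

lemma inner_adjoint_comp_comp {K : Type*} [NormedAddCommGroup K] [InnerProductSpace ℂ K]
    [CompleteSpace K] (L L' : h →L[ℂ] K) (J : K →L[ℂ] K) (b a : h) :
    ⟪b, ((ContinuousLinearMap.adjoint L) ∘L J ∘L L') a⟫_ℂ = ⟪L b, J (L' a)⟫_ℂ :=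
  ContinuousLinearMap.adjoint_inner_right L b (J (L' a))

/-- The matrix elements of `J_ρ(Φ_*)` extend from basis vectors to arbitrary vectors in the second
tensor factor. -/
lemma IsChoi.inner_htmul {e : HilbertBasis ι ℂ h} {ρ : h →L[ℂ] h}
    {Φs : (h →L[ℂ] h) → (h →L[ℂ] h)} {J : HTensor h →L[ℂ] HTensor h}
    (hJ : IsChoi e ρ Φs J) (k k' : ι) (b a : h) :
    ⟪htmul (e k) b, J (htmul (e k') a)⟫_ℂ =
      ⟪b, Φs (rankOne ℂ (CFC.sqrt ρ (e k)) (CFC.sqrt ρ (e k'))) a⟫_ℂ := by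
  have h1 : (ContinuousLinearMap.adjoint (htmulL (e k))) ∘L J ∘L htmulL (e k') =
      Φs (rankOne ℂ (CFC.sqrt ρ (e k)) (CFC.sqrt ρ (e k'))) := by
    refine ext_inner_apply_basis e fun l l' => ?_
    rw [← hJ, inner_adjoint_comp_comp]
    rfl
  rw [← h1, inner_adjoint_comp_comp]
  rfl

end ChoiState

/-! ### Anti-unitary involutions -/

section TimeReversal

open InnerProductSpace (rankOne)

variable {h : Type*} [NormedAddCommGroup h] [InnerProductSpace ℂ h] [CompleteSpace h]
  {ι : Type*}

omit [CompleteSpace h] in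
/-- By polarization: `θ` is conjugate linear, so it changes the sign of the imaginary part only. -/
lemma inner_antiunitary (θ : h ≃ₗᵢ⋆[ℂ] h) (x y : h) : ⟪θ x, θ y⟫_ℂ = ⟪y, x⟫_ℂ := by
  have hI : θ (Complex.I • y) = -(Complex.I • θ y) := by
    rw [map_smulₛₗ, Complex.conj_I, neg_smul]
  have h1 : θ x - Complex.I • θ y = θ (x + Complex.I • y) := by rw [map_add, hI, sub_eq_add_neg]
  have h2 : θ x + Complex.I • θ y = θ (x - Complex.I • y) := by rw [map_sub, hI, sub_neg_eq_add]
  have h4 : starRingEnd ℂ 4 = 4 := map_ofNat _ 4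
  rw [← inner_conj_symm y x, inner_eq_sum_norm_sq_div_four, inner_eq_sum_norm_sq_div_four x y,
    RCLike.I_to_complex, h1, h2, ← map_add, ← map_sub]
  simp only [LinearIsometryEquiv.norm_map]
  simp [h4]
  ring

omit [CompleteSpace h] in
lemma inner_involution_left {θ : h ≃ₗᵢ⋆[ℂ] h} (hθ : ∀ u, θ (θ u) = u) (x y : h) :
    ⟪θ x, y⟫_ℂ = ⟪θ y, x⟫_ℂ := by
  conv_lhs => rw [← hθ y]
  exact inner_antiunitary θ x (θ y)

lemma reversing_apply (θ : h ≃ₗᵢ⋆[ℂ] h) (x : h →L[ℂ] h) (u : h) :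
    reversing θ x u = θ (ContinuousLinearMap.adjoint x (θ u)) := rfl

/-- `θ ρ^½ θ` is positive with square `θ ρ θ = ρ`, hence equal to `ρ^½`. -/
lemma sqrt_apply_comm {θ : h ≃ₗᵢ⋆[ℂ] h} (hθ : ∀ u, θ (θ u) = u) {ρ : h →L[ℂ] h} (hρ : 0 ≤ ρ)
    (hθρ : ∀ u, θ (ρ u) = ρ (θ u)) (u : h) : CFC.sqrt ρ (θ u) = θ (CFC.sqrt ρ u) := by
  have hs : ContinuousLinearMap.adjoint (CFC.sqrt ρ) = CFC.sqrt ρ :=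
    (CFC.sqrt_nonneg ρ).isSelfAdjoint.adjoint_eq
  have hsq (v : h) : CFC.sqrt ρ (CFC.sqrt ρ v) = ρ v :=
    DFunLike.congr_fun (CFC.sqrt_mul_sqrt_self ρ hρ) v
  have h1 : CFC.sqrt ρ = reversing θ (CFC.sqrt ρ) := by
    refine CFC.sqrt_unique ?_ ?_
    · ext v
      change θ (ContinuousLinearMap.adjoint (CFC.sqrt ρ) (θ (θ (ContinuousLinearMap.adjoint
        (CFC.sqrt ρ) (θ v))))) = ρ v
      rw [hs, hθ, hsq, hθρ, hθ]
    · have hp : (CFC.sqrt ρ).IsPositive :=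
        (ContinuousLinearMap.nonneg_iff_isPositive _).1 (CFC.sqrt_nonneg ρ)
      rw [ContinuousLinearMap.nonneg_iff_isPositive, ContinuousLinearMap.isPositive_iff_complex]
      intro x
      have h1 : ⟪reversing θ (CFC.sqrt ρ) x, x⟫_ℂ = ⟪CFC.sqrt ρ (θ x), θ x⟫_ℂ := by
        rw [reversing_apply, hs, inner_involution_left hθ, ← ContinuousLinearMap.adjoint_inner_left,
          hs]
      rw [h1]
      exact (ContinuousLinearMap.isPositive_iff_complex _).1 hp (θ x)
  conv_lhs => rw [h1]
  rw [reversing_apply, hs, hθ]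

end TimeReversal

/-! ### The involution exchanging the two Choi operators -/

section Swap

open InnerProductSpace (rankOne)

variable {h : Type*} [NormedAddCommGroup h] [InnerProductSpace ℂ h] [CompleteSpace h]
  {ι : Type*}

/-- In terms of the pre-dual maps, `Θ`-KMS duality exchanges the vectors in the two tensor factors
of the Choi operator. -/
lemma inner_predual_of_thetaKMS {ρ : h →L[ℂ] h} (hρ : 0 ≤ ρ) {θ : h ≃ₗᵢ⋆[ℂ] h}
    (hθ : ∀ u, θ (θ u) = u) (hθρ : ∀ u, θ (ρ u) = ρ (θ u)) {T T' : UniformQMS h}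
    (hT : T.IsThetaKMSAdjoint T' θ ρ) (t : ℝ≥0) (u v a b : h) :
    ⟪b, predual (T.map t) (rankOne ℂ (CFC.sqrt ρ (θ u)) (CFC.sqrt ρ (θ v))) a⟫_ℂ =
      ⟪u, predual (T'.map t) (rankOne ℂ (CFC.sqrt ρ (θ b)) (CFC.sqrt ρ (θ a))) v⟫_ℂ := by
  have hs : ContinuousLinearMap.adjoint (CFC.sqrt ρ) = CFC.sqrt ρ :=
    (CFC.sqrt_nonneg ρ).isSelfAdjoint.adjoint_eq
  rw [(T.normal t).inner_predual_rankOne, (T'.normal t).inner_predual_rankOne]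
  have key := hT t (rankOne ℂ u v) (rankOne ℂ a b)
  have hrev : reversing θ (ContinuousLinearMap.adjoint (rankOne ℂ u v)) =
      rankOne ℂ (θ u) (θ v) := by
    ext w
    rw [reversing_apply, ContinuousLinearMap.adjoint_adjoint, InnerProductSpace.rankOne_apply,
      InnerProductSpace.rankOne_apply, map_smulₛₗ, inner_conj_symm, inner_involution_left hθ]
  have hl : CFC.sqrt ρ ∘L rankOne ℂ (θ u) (θ v) ∘L CFC.sqrt ρ ∘L T.map t (rankOne ℂ a b) =
      rankOne ℂ (CFC.sqrt ρ (θ u)) (CFC.sqrt ρ (θ v)) ∘L T.map t (rankOne ℂ a b) := by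
    conv_rhs => rw [← InnerProductSpace.comp_rankOne, ← hs, ← InnerProductSpace.rankOne_comp]
    rw [hs]
    rfl
  have hr (Y : h →L[ℂ] h) : opTrace (CFC.sqrt ρ ∘L reversing θ Y ∘L CFC.sqrt ρ ∘L rankOne ℂ a b) =
      ⟪CFC.sqrt ρ (θ a), Y (CFC.sqrt ρ (θ b))⟫_ℂ := by
    rw [← ContinuousLinearMap.comp_assoc, ← ContinuousLinearMap.comp_assoc, opTrace_comp_rankOne]
    change ⟪b, CFC.sqrt ρ (θ (ContinuousLinearMap.adjoint Y (θ (CFC.sqrt ρ a))))⟫_ℂ = _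
    rw [← ContinuousLinearMap.adjoint_inner_left, hs, ← hθ (CFC.sqrt ρ b),
      inner_antiunitary, ContinuousLinearMap.adjoint_inner_left, sqrt_apply_comm hθ hρ hθρ,
      sqrt_apply_comm hθ hρ hθρ]
  rw [hrev, hl, opTrace_rankOne_comp, hr, InnerProductSpace.adjoint_rankOne] at key
  exact key

lemma exists_antiunitary_basis (e : HilbertBasis ι ℂ h) {θ : h ≃ₗᵢ⋆[ℂ] h}
    (hθ : ∀ u, θ (θ u) = u) : ∃ e' : HilbertBasis ι ℂ h, ∀ i, e' i = θ (e i) := by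
  classical
  have hon : Orthonormal ℂ fun i => θ (e i) := by
    rw [orthonormal_iff_ite]
    intro i j
    rw [inner_antiunitary, orthonormal_iff_ite.1 e.orthonormal]
    simp only [eq_comm]
  refine ⟨HilbertBasis.mkOfOrthogonalEqBot hon ?_, fun i => ?_⟩
  · rw [Submodule.eq_bot_iff]
    intro x hx
    have h0 : θ x = 0 := ext_inner_basis e fun i => by
      rw [inner_zero_right, ← hθ (e i), inner_antiunitary]
      exact (Submodule.mem_orthogonal' _ _).1 hx _ (Submodule.subset_span ⟨i, rfl⟩)
    rw [← hθ x, h0, map_zero]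
  · rw [HilbertBasis.coe_mkOfOrthogonalEqBot]

lemma exists_unitary_permuting_basis (f : HilbertBasis ι ℂ h)
    (σ : Equiv.Perm ι) : ∃ W : h ≃ₗᵢ[ℂ] h, ∀ p, W (f p) = f (σ p) := by
  classical
  have hsp : ⊤ ≤ (Submodule.span ℂ (Set.range (f ∘ σ))).topologicalClosure := by
    rw [Set.range_comp, σ.surjective.range_eq, Set.image_univ, f.dense_span]
  have hon : Orthonormal ℂ (f ∘ σ) := f.orthonormal.comp σ σ.injective
  refine ⟨f.repr.trans (HilbertBasis.mk hon hsp).repr.symm, fun p => ?_⟩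
  rw [LinearIsometryEquiv.trans_apply, f.repr_self, HilbertBasis.repr_symm_single,
    HilbertBasis.coe_mk, Function.comp_apply]

/-- The Choi operators of a semigroup and of its `Θ`-KMS adjoint are conjugate by the unitary
involution of `h ⊗ h` that swaps the indices of the orthonormal basis `e_k ⊗ θ e_l`. -/
lemma exists_involution_choi (e : HilbertBasis ι ℂ h) {ρ : h →L[ℂ] h} (hρ : 0 ≤ ρ)
    {θ : h ≃ₗᵢ⋆[ℂ] h} (hθ : ∀ u, θ (θ u) = u) (hθρ : ∀ u, θ (ρ u) = ρ (θ u))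
    {T T' : UniformQMS h} (hT : T.IsThetaKMSAdjoint T' θ ρ) (t : ℝ≥0)
    {J J' : HTensor h →L[ℂ] HTensor h} (hJ : IsChoi e ρ (predual (T.map t)) J)
    (hJ' : IsChoi e ρ (predual (T'.map t)) J') :
    ∃ W : HTensor h ≃ₗᵢ[ℂ] HTensor h, (∀ x, W (W x) = x) ∧ ∀ x, J' x = W (J (W x)) := by
  obtain ⟨e', he'⟩ := exists_antiunitary_basis e hθ
  obtain ⟨f, hf⟩ := exists_htmul_basis e e'
  obtain ⟨W, hW⟩ := exists_unitary_permuting_basis f (Equiv.prodComm ι ι)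
  have hWW (x : HTensor h) : W (W x) = x :=
    DFunLike.congr_fun (ext_apply_basis f
      (A := (W : HTensor h →L[ℂ] HTensor h) ∘L (W : HTensor h →L[ℂ] HTensor h))
      (B := ContinuousLinearMap.id ℂ _) fun p => by
        change W (W (f p)) = f p
        rw [hW, hW]
        rfl) x
  refine ⟨W, hWW, fun x => ?_⟩
  refine DFunLike.congr_fun (ext_inner_apply_basis f (A := J')
    (B := (W : HTensor h →L[ℂ] HTensor h) ∘L J ∘L (W : HTensor h →L[ℂ] HTensor h))
    fun p q => ?_) x
  change _ = ⟪f p, W (J (W (f q)))⟫_ℂ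
  conv_rhs => rw [← W.inner_map_map (f p), hWW, hW, hW]
  rw [hf, hf, hf, hf, he', he', he', he']
  change _ = ⟪htmul (e p.2) (θ (e p.1)), J (htmul (e q.2) (θ (e q.1)))⟫_ℂ
  rw [hJ.inner_htmul, hJ'.inner_htmul]
  have h1 := inner_predual_of_thetaKMS hρ hθ hθρ hT t (θ (e p.2)) (θ (e q.2)) (θ (e q.1))
    (θ (e p.1))
  rw [hθ, hθ, hθ, hθ] at h1
  exact h1.symm

end Swap

/-! ### Eigenprojections and overlaps -/

section EigenProj

variable {H : Type*} [NormedAddCommGroup H] [InnerProductSpace ℂ H] [CompleteSpace H]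

omit [CompleteSpace H] in
lemma mem_ker_sub_smul_one {A : H →L[ℂ] H} {r : ℝ} {x : H} :
    x ∈ (A - (r : ℂ) • (1 : H →L[ℂ] H)).ker ↔ A x = (r : ℂ) • x :=
  sub_eq_zero

lemma apply_eigenProj (A : H →L[ℂ] H) (r : ℝ) (x : H) :
    A (eigenProj A r x) = (r : ℂ) • eigenProj A r x :=
  mem_ker_sub_smul_one.1 (Submodule.starProjection_apply_mem _ x)

lemma inner_eigenProj_left (A : H →L[ℂ] H) (r : ℝ) (x y : H) :
    ⟪eigenProj A r x, y⟫_ℂ = ⟪x, eigenProj A r y⟫_ℂ :=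
  Submodule.inner_starProjection_left_eq_right _ x y

lemma eigenProj_of_apply_eq {A : H →L[ℂ] H} {r : ℝ} {x : H} (hx : A x = (r : ℂ) • x) :
    eigenProj A r x = x :=
  Submodule.starProjection_eq_self_iff.2 (mem_ker_sub_smul_one.2 hx)

lemma inner_eq_zero_of_eigenvalue_ne {A : H →L[ℂ] H} (hA : IsSelfAdjoint A) {r s : ℝ}
    (hrs : r ≠ s) {x y : H} (hx : A x = (r : ℂ) • x) (hy : A y = (s : ℂ) • y) :
    ⟪x, y⟫_ℂ = 0 := by
  have h1 : ⟪A x, y⟫_ℂ = ⟪x, A y⟫_ℂ := by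
    rw [← ContinuousLinearMap.adjoint_inner_left, hA.adjoint_eq]
  rw [hx, hy, inner_smul_left, inner_smul_right, Complex.conj_ofReal] at h1
  have h2 : ((r : ℂ) - s) * ⟪x, y⟫_ℂ = 0 := by rw [sub_mul, h1, sub_self]
  refine (mul_eq_zero.1 h2).resolve_left fun h3 => hrs ?_
  exact_mod_cast sub_eq_zero.1 h3

lemma eigenProj_of_apply_eq_of_ne {A : H →L[ℂ] H} (hA : IsSelfAdjoint A) {r s : ℝ} (hrs : r ≠ s)
    {x : H} (hx : A x = (s : ℂ) • x) : eigenProj A r x = 0 := by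
  rw [← inner_self_eq_zero (𝕜 := ℂ), inner_eigenProj_left,
    eigenProj_of_apply_eq (apply_eigenProj A r x)]
  exact inner_eq_zero_of_eigenvalue_ne hA hrs.symm hx (apply_eigenProj A r x)

/-- If `ker B ⊆ ker A`, the projection onto `ker B` annihilates the eigenvectors of `A` with nonzero
eigenvalue, as these are orthogonal to `ker A`. -/
lemma eigenProj_zero_eigenProj {A B : H →L[ℂ] H} (hA : IsSelfAdjoint A) (hker : B.ker ≤ A.ker)
    {r : ℝ} (hr : r ≠ 0) (x : H) : eigenProj B 0 (eigenProj A r x) = 0 := by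
  have h1 : A (eigenProj B 0 (eigenProj A r x)) =
      ((0 : ℝ) : ℂ) • eigenProj B 0 (eigenProj A r x) := by
    have h2 := apply_eigenProj B 0 (eigenProj A r x)
    rw [Complex.ofReal_zero, zero_smul] at h2 ⊢
    exact hker h2
  rw [← inner_self_eq_zero (𝕜 := ℂ), inner_eigenProj_left,
    eigenProj_of_apply_eq (apply_eigenProj B 0 _)]
  exact inner_eq_zero_of_eigenvalue_ne hA hr (apply_eigenProj A r x) h1

lemma eigenProj_of_neg {A : H →L[ℂ] H} (hA : 0 ≤ A) {r : ℝ} (hr : r < 0) (x : H) :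
    eigenProj A r x = 0 := by
  have h1 := inner_apply_self_eq_norm_sqrt_sq hA (eigenProj A r x)
  rw [apply_eigenProj, inner_smul_right, inner_self_eq_ofReal] at h1
  have h2 : r * ‖eigenProj A r x‖ ^ 2 = ‖CFC.sqrt A (eigenProj A r x)‖ ^ 2 := by
    exact_mod_cast h1
  by_contra hne
  have h3 : 0 < ‖eigenProj A r x‖ ^ 2 := by positivity
  nlinarith [sq_nonneg ‖CFC.sqrt A (eigenProj A r x)‖]

/-- If `C` is positive and acts as the scalar `c r` on the eigenspace of `A` at `r`, then
`∑ r, c_r P_r ≤ C` for every finite set of eigenvalues, as `C` commutes with the `P_r`. -/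
lemma sum_mul_norm_eigenProj_sq_le {A C : H →L[ℂ] H} (hA : IsSelfAdjoint A) (hC : 0 ≤ C)
    (c : ℝ → ℝ) (hc : ∀ r x, C (eigenProj A r x) = (c r : ℂ) • eigenProj A r x) (F : Finset ℝ)
    (x : H) : ∑ r ∈ F, c r * ‖eigenProj A r x‖ ^ 2 ≤ (⟪x, C x⟫_ℂ).re := by
  classical
  have hCs : ContinuousLinearMap.adjoint C = C := hC.isSelfAdjoint.adjoint_eq
  set y := ∑ r ∈ F, eigenProj A r x with hy
  have hPx (r : ℝ) : ⟪x, eigenProj A r x⟫_ℂ = ((‖eigenProj A r x‖ ^ 2 : ℝ) : ℂ) := by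
    rw [← eigenProj_of_apply_eq (apply_eigenProj A r x), ← inner_eigenProj_left,
      eigenProj_of_apply_eq (apply_eigenProj A r x), inner_self_eq_ofReal, Complex.ofReal_pow]
  have hPy (r : ℝ) (hr : r ∈ F) : eigenProj A r y = eigenProj A r x := by
    rw [hy, map_sum, Finset.sum_eq_single_of_mem r hr fun s _ hs =>
      eigenProj_of_apply_eq_of_ne hA hs.symm (apply_eigenProj A s x),
      eigenProj_of_apply_eq (apply_eigenProj A r x)]
  have hCy : C y = ∑ r ∈ F, (c r : ℂ) • eigenProj A r x := by
    rw [hy, map_sum]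
    exact Finset.sum_congr rfl fun r _ => hc r x
  have h1 : ⟪x, C y⟫_ℂ = ((∑ r ∈ F, c r * ‖eigenProj A r x‖ ^ 2 : ℝ) : ℂ) := by
    rw [hCy, inner_sum]
    simp only [inner_smul_right, hPx]
    push_cast
    rfl
  have h2 : ⟪y, C y⟫_ℂ = ((∑ r ∈ F, c r * ‖eigenProj A r x‖ ^ 2 : ℝ) : ℂ) := by
    rw [← h1, hCy, inner_sum, inner_sum]
    refine Finset.sum_congr rfl fun r hr => ?_
    have h5 : ⟪y, eigenProj A r x⟫_ℂ = ⟪x, eigenProj A r x⟫_ℂ := by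
      rw [← eigenProj_of_apply_eq (apply_eigenProj A r x), ← inner_eigenProj_left, hPy r hr,
        inner_eigenProj_left]
    rw [inner_smul_right, inner_smul_right, h5]
  have h3 : ⟪y, C x⟫_ℂ = ((∑ r ∈ F, c r * ‖eigenProj A r x‖ ^ 2 : ℝ) : ℂ) := by
    rw [← ContinuousLinearMap.adjoint_inner_left, hCs, ← inner_conj_symm, h1, Complex.conj_ofReal]
  -- Expanding `0 ≤ ⟨x - y, C (x - y)⟩`, the three terms containing `y` agree up to sign.
  have h4 := inner_apply_self_eq_norm_sqrt_sq hC (x - y)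
  rw [map_sub, inner_sub_left, inner_sub_right, inner_sub_right, h1, h2, h3] at h4
  have h5 := congrArg Complex.re h4
  simp only [Complex.sub_re, Complex.ofReal_re] at h5
  have h6 := sq_nonneg ‖CFC.sqrt C (x - y)‖
  linarith

lemma tsum_norm_eigenProj_sq_le {A : H →L[ℂ] H} (hA : IsSelfAdjoint A) (x : H) :
    ∑' r : ℝ, ENNReal.ofReal (‖eigenProj A r x‖ ^ 2) ≤ ENNReal.ofReal (‖x‖ ^ 2) := by
  rw [ENNReal.tsum_eq_iSup_sum]
  refine iSup_le fun F => ?_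
  rw [← ENNReal.ofReal_sum_of_nonneg fun _ _ => by positivity]
  refine ENNReal.ofReal_le_ofReal ?_
  have h1 := sum_mul_norm_eigenProj_sq_le hA (C := 1) zero_le_one (fun _ => 1) (by simp) F x
  rw [one_apply_eq_self, inner_self_eq_ofReal, ← Complex.ofReal_pow,
    Complex.ofReal_re] at h1
  simpa using h1

lemma tsum_mul_norm_eigenProj_sq_le {A : H →L[ℂ] H} (hA : 0 ≤ A) (x : H) :
    ∑' r : ℝ, ENNReal.ofReal (‖eigenProj A r x‖ ^ 2) * ENNReal.ofReal r ≤
      ENNReal.ofReal (‖CFC.sqrt A x‖ ^ 2) := by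
  rw [ENNReal.tsum_eq_iSup_sum]
  refine iSup_le fun F => ?_
  simp only [← ENNReal.ofReal_mul (sq_nonneg _)]
  have hnn (r : ℝ) : 0 ≤ ‖eigenProj A r x‖ ^ 2 * r := by
    rcases lt_or_ge r 0 with hr | hr
    · rw [eigenProj_of_neg hA hr]
      simp
    · positivity
  rw [← ENNReal.ofReal_sum_of_nonneg fun r _ => hnn r]
  refine ENNReal.ofReal_le_ofReal ?_
  have h1 := sum_mul_norm_eigenProj_sq_le hA.isSelfAdjoint hA id (apply_eigenProj A) F x
  rw [inner_apply_self_eq_norm_sqrt_sq hA, Complex.ofReal_re] at h1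
  simpa only [mul_comm, id] using h1

lemma adjoint_eigenProj (A : H →L[ℂ] H) (r : ℝ) :
    ContinuousLinearMap.adjoint (eigenProj A r) = eigenProj A r :=
  (isSelfAdjoint_starProjection _).adjoint_eq

lemma overlap_eq_hsSq (A B : H →L[ℂ] H) (r s : ℝ) :
    overlap A B r s = hsSq (onb H) (eigenProj B s ∘L eigenProj A r) := rfl

lemma overlap_eq_hsSq_basis {κ : Type*} (b : HilbertBasis κ ℂ H) (A B : H →L[ℂ] H) (r s : ℝ) :
    overlap A B r s = hsSq b (eigenProj B s ∘L eigenProj A r) := by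
  rw [overlap_eq_hsSq, hsSq_eq_hsSq (onb H) b]

lemma overlap_swap (A B : H →L[ℂ] H) (r s : ℝ) : overlap A B r s = overlap B A s r := by
  rw [overlap_eq_hsSq, overlap_eq_hsSq, ← hsSq_adjoint (onb H) (onb H),
    ContinuousLinearMap.adjoint_comp, adjoint_eigenProj, adjoint_eigenProj]

/-- `∑ r, ∑ s, s tr (P_r Q_s) ≤ tr B = 1`. -/
lemma tsum_overlap_mul_le_one {A B : H →L[ℂ] H} (hA : 0 ≤ A) (hB : IsState B) :
    ∑' r : ℝ, ∑' s : ℝ, overlap A B r s * ENNReal.ofReal s ≤ 1 := by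
  have h1 (s : ℝ) : ∑' r : ℝ, overlap A B r s ≤
      ∑' i, ENNReal.ofReal (‖eigenProj B s (onb H i)‖ ^ 2) := by
    have h2 (r : ℝ) : overlap A B r s =
        ∑' i, ENNReal.ofReal (‖eigenProj A r (eigenProj B s (onb H i))‖ ^ 2) :=
      overlap_swap A B r s
    simp only [h2]
    rw [ENNReal.tsum_comm]
    exact ENNReal.tsum_le_tsum fun i => tsum_norm_eigenProj_sq_le hA.isSelfAdjoint _
  calc ∑' r : ℝ, ∑' s : ℝ, overlap A B r s * ENNReal.ofReal s
      = ∑' s : ℝ, (∑' r : ℝ, overlap A B r s) * ENNReal.ofReal s := by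
        rw [ENNReal.tsum_comm]
        simp only [ENNReal.tsum_mul_right]
    _ ≤ ∑' s : ℝ, (∑' i, ENNReal.ofReal (‖eigenProj B s (onb H i)‖ ^ 2)) * ENNReal.ofReal s :=
        ENNReal.tsum_le_tsum fun s => mul_le_mul_left (h1 s) _
    _ = ∑' i, ∑' s : ℝ, ENNReal.ofReal (‖eigenProj B s (onb H i)‖ ^ 2) * ENNReal.ofReal s := by
        simp only [← ENNReal.tsum_mul_right]
        rw [ENNReal.tsum_comm]
    _ ≤ ∑' i, ENNReal.ofReal (‖CFC.sqrt B (onb H i)‖ ^ 2) :=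
        ENNReal.tsum_le_tsum fun i => tsum_mul_norm_eigenProj_sq_le hB.1 _
    _ = 1 := by
        have h2 := hB.2.1.hasSum hB.1 (onb H)
        simp only [inner_apply_self_eq_norm_sqrt_sq hB.1, hB.2.2] at h2
        have h3 : HasSum (fun i => ‖CFC.sqrt B (onb H i)‖ ^ 2) 1 :=
          Complex.hasSum_ofReal.1 (by simpa using h2)
        rw [← ENNReal.ofReal_tsum_of_nonneg (fun _ => by positivity) h3.summable, h3.tsum_eq,
          ENNReal.ofReal_one]

end EigenProj

/-! ### Symmetrising the relative entropy -/

section Entropy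

variable {H : Type*} [NormedAddCommGroup H] [InnerProductSpace ℂ H] [CompleteSpace H]

lemma eigenProj_conj {A B : H →L[ℂ] H} {W : H ≃ₗᵢ[ℂ] H} (hW : ∀ x, W (W x) = x)
    (hB : ∀ x, B x = W (A (W x))) (s : ℝ) (x : H) :
    eigenProj B s x = W (eigenProj A s (W x)) := by
  -- `W P_s W x` is the orthogonal projection of `x`: `W` maps the eigenspace of `B` onto that of `A`.
  refine Submodule.eq_starProjection_of_mem_of_inner_eq_zero ?_ fun w hw => ?_
  · rw [mem_ker_sub_smul_one, hB, hW, apply_eigenProj, map_smul]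
  · rw [mem_ker_sub_smul_one, hB] at hw
    have hw' : A (W w) = (s : ℂ) • W w := by rw [← map_smul, ← hw, hW]
    rw [← W.inner_map_map, map_sub, hW]
    exact Submodule.starProjection_inner_eq_zero _ _ (mem_ker_sub_smul_one.2 hw')

/-- For `B = W A W`, `tr (P_r Q_s) = tr (P_r W P_s W)` is symmetric in `r` and `s`. -/
lemma overlap_comm {A B : H →L[ℂ] H} {W : H ≃ₗᵢ[ℂ] H} (hW : ∀ x, W (W x) = x)
    (hB : ∀ x, B x = W (A (W x))) (r s : ℝ) : overlap A B r s = overlap A B s r := by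
  have h1 (r s : ℝ) : overlap A B r s =
      hsSq (onb H) (eigenProj A s ∘L (W : H →L[ℂ] H) ∘L eigenProj A r) := by
    refine tsum_congr fun i => ?_
    rw [eigenProj_conj hW hB, W.norm_map]
    rfl
  have h2 : ContinuousLinearMap.adjoint (W : H →L[ℂ] H) = (W : H →L[ℂ] H) := by
    refine (ContinuousLinearMap.eq_adjoint_iff _ _).2 (fun x y => ?_) |>.symm
    change ⟪W x, y⟫_ℂ = ⟪x, W y⟫_ℂ
    rw [← W.inner_map_map, hW]
  rw [h1, h1, ← hsSq_adjoint (onb H) (onb H), ContinuousLinearMap.adjoint_comp,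
    ContinuousLinearMap.adjoint_comp, adjoint_eigenProj, adjoint_eigenProj, h2,
    ContinuousLinearMap.comp_assoc]

lemma ofReal_add_ofReal_of_add_nonneg {x y : ℝ} (hxy : 0 ≤ x + y) :
    ENNReal.ofReal x + ENNReal.ofReal y =
      ENNReal.ofReal (x + y) + (ENNReal.ofReal (-x) + ENNReal.ofReal (-y)) := by
  rcases le_total 0 x with hx | hx <;> rcases le_total 0 y with hy | hy
  · rw [ENNReal.ofReal_add hx hy, ENNReal.ofReal_of_nonpos (neg_nonpos.2 hx),
      ENNReal.ofReal_of_nonpos (neg_nonpos.2 hy), add_zero, add_zero]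
  · rw [ENNReal.ofReal_of_nonpos hy, ENNReal.ofReal_of_nonpos (neg_nonpos.2 hx), zero_add, add_zero,
      ← ENNReal.ofReal_add hxy (neg_nonneg.2 hy)]
    congr 1
    ring
  · rw [ENNReal.ofReal_of_nonpos hx, ENNReal.ofReal_of_nonpos (neg_nonpos.2 hy), zero_add, add_zero,
      ← ENNReal.ofReal_add hxy (neg_nonneg.2 hx)]
    congr 1
    ring
  · have hx0 : x = 0 := by linarith
    have hy0 : y = 0 := by linarith
    simp [hx0, hy0]

/-- From `log (s / r) ≤ s / r - 1`; the case `r = 0` uses only that the left-hand side is `0`. -/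
lemma mul_log_sub_mul_log_le {r s : ℝ} (hr : 0 ≤ r) (hs : 0 ≤ s) (h0 : s = 0 → r = 0) :
    -(r * Real.log r - r * Real.log s) ≤ s := by
  rcases hr.eq_or_lt with rfl | hr
  · simpa using hs
  have hs' : 0 < s := lt_of_le_of_ne hs fun h => hr.ne' (h0 h.symm)
  have h1 := Real.log_le_sub_one_of_pos (div_pos hs' hr)
  rw [Real.log_div hs'.ne' hr.ne'] at h1
  have h2 := mul_le_mul_of_nonneg_left h1 hr.le
  have h3 : r * (s / r - 1) = s - r := by field_simp
  linarith

lemma sub_mul_log_sub_log_nonneg {r s : ℝ} (hr : 0 ≤ r) (hs : 0 ≤ s) (h0 : r = 0 ↔ s = 0) :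
    0 ≤ (r - s) * (Real.log r - Real.log s) := by
  rcases hr.eq_or_lt with rfl | hr
  · simp [h0.1 rfl]
  have hs' : 0 < s := lt_of_le_of_ne hs fun h => hr.ne' (h0.2 h.symm)
  rcases le_total r s with h | h
  · exact mul_nonneg_of_nonpos_of_nonpos (by linarith) (by linarith [Real.log_le_log hr h])
  · exact mul_nonneg (by linarith) (by linarith [Real.log_le_log hs' h])

/-- With `F(r, s) = r log r - r log s`, symmetry of the overlaps lets one replace `F(r, s)` by
`(F(r, s) + F(s, r)) / 2 = (r - s) (log r - log s) / 2` in the sum defining the relative entropy;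
the sum of the negative parts of `F` is finite, so no `∞ - ∞` occurs. -/
theorem relEntropy_eq_half_symTrace {A B : H →L[ℂ] H} (hA : IsState A) (hB : IsState B)
    {W : H ≃ₗᵢ[ℂ] H} (hW : ∀ x, W (W x) = x) (hWB : ∀ x, B x = W (A (W x)))
    (hker : B.ker ≤ A.ker) :
    relEntropy A B = ((1 / 2 : ℝ) : EReal) * symTrace A B := by
  have hcomm := overlap_comm hW hWB
  have hneg (r s : ℝ) (hr : r < 0) : overlap A B r s = 0 := by
    simp [overlap, eigenProj_of_neg hA.1 hr]
  have hzero (r : ℝ) (hr : r ≠ 0) : overlap A B r 0 = 0 := by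
    simp [overlap, eigenProj_zero_eigenProj hA.1.isSelfAdjoint hker hr]
  -- On the support of the overlaps the value of the logarithm at `0` does not matter.
  have hsupp (r s : ℝ) : overlap A B r s = 0 ∨ (0 ≤ r ∧ 0 ≤ s ∧ (r = 0 ↔ s = 0)) := by
    by_contra! hcon
    obtain ⟨h1, h2⟩ := hcon
    have hr : 0 ≤ r := not_lt.1 fun h => h1 (hneg r s h)
    have hs : 0 ≤ s := not_lt.1 fun h => h1 (by rw [hcomm, hneg s r h])
    rcases h2 hr hs with ⟨rfl, h3⟩ | ⟨h3, rfl⟩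
    · exact h1 (by rw [hcomm, hzero s h3])
    · exact h1 (hzero r h3)
  set F : ℝ → ℝ → ℝ := fun r s => r * Real.log r - r * Real.log s with hF
  set o := overlap A B
  set Sp := ∑' r : ℝ, ∑' s : ℝ, o r s * ENNReal.ofReal (F r s) with hSp
  set Sn := ∑' r : ℝ, ∑' s : ℝ, o r s * ENNReal.ofReal (-F r s) with hSn
  set G := ∑' r : ℝ, ∑' s : ℝ,
    o r s * ENNReal.ofReal ((r - s) * (Real.log r - Real.log s)) with hG
  have hSn_top : Sn ≠ ⊤ := by
    refine ne_top_of_le_ne_top ENNReal.one_ne_top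
      (le_trans ?_ (tsum_overlap_mul_le_one hA.1 hB))
    refine ENNReal.tsum_le_tsum fun r => ENNReal.tsum_le_tsum fun s => ?_
    rcases hsupp r s with h0 | ⟨hr, hs, h0⟩
    · simp [o, h0]
    · exact mul_le_mul_right (ENNReal.ofReal_le_ofReal (mul_log_sub_mul_log_le hr hs h0.2)) _
  have hflip (f : ℝ → ℝ → ℝ) : ∑' r : ℝ, ∑' s : ℝ, o r s * ENNReal.ofReal (f s r) =
      ∑' r : ℝ, ∑' s : ℝ, o r s * ENNReal.ofReal (f r s) := by
    rw [ENNReal.tsum_comm]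
    exact tsum_congr fun r => tsum_congr fun s => by rw [hcomm]
  have hsum : Sp + Sp = G + (Sn + Sn) := by
    have h1 : Sp + Sp = ∑' r : ℝ, ∑' s : ℝ,
        o r s * (ENNReal.ofReal (F r s) + ENNReal.ofReal (F s r)) := by
      simp only [mul_add, ENNReal.tsum_add]
      rw [hflip F]
    have h2 : Sn + Sn = ∑' r : ℝ, ∑' s : ℝ,
        o r s * (ENNReal.ofReal (-F r s) + ENNReal.ofReal (-F s r)) := by
      simp only [mul_add, ENNReal.tsum_add]
      rw [hflip fun r s => -F r s]
    rw [h1, h2, hG]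
    simp only [← ENNReal.tsum_add, ← mul_add]
    refine tsum_congr fun r => tsum_congr fun s => ?_
    rcases hsupp r s with h0 | ⟨hr, hs, h0⟩
    · simp [o, h0]
    · have h3 : (r - s) * (Real.log r - Real.log s) = F r s + F s r := by
        simp only [hF]
        ring
      have h4 := sub_mul_log_sub_log_nonneg hr hs h0
      rw [h3] at h4 ⊢
      rw [ofReal_add_ofReal_of_add_nonneg h4]
  have hGn : ∑' r : ℝ, ∑' s : ℝ,
      o r s * ENNReal.ofReal (-((r - s) * (Real.log r - Real.log s))) = 0 := by
    simp only [ENNReal.tsum_eq_zero]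
    intro r s
    rcases hsupp r s with h0 | ⟨hr, hs, h0⟩
    · simp [o, h0]
    · rw [ENNReal.ofReal_of_nonpos (neg_nonpos.2 (sub_mul_log_sub_log_nonneg hr hs h0)), mul_zero]
  have hrel : relEntropy A B = (Sp : EReal) - (Sn : EReal) := if_pos hker
  have hsym : symTrace A B = (G : EReal) := by
    change (G : EReal) - ((∑' r : ℝ, ∑' s : ℝ,
      o r s * ENNReal.ofReal (-((r - s) * (Real.log r - Real.log s))) : ℝ≥0∞) : EReal) = _
    rw [hGn, EReal.coe_ennreal_zero, sub_zero]
  rw [hrel, hsym]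
  clear_value Sp Sn G
  lift Sn to ℝ≥0 using hSn_top
  by_cases hGt : G = ⊤
  · have hSpt : Sp = ⊤ := by
      rw [hGt, top_add, ENNReal.add_eq_top, or_self] at hsum
      exact hsum
    rw [hGt, hSpt, EReal.coe_ennreal_top, EReal.coe_mul_top_of_pos (by norm_num)]
    rfl
  · have hSpt : Sp ≠ ⊤ := fun h => by
      rw [h, top_add] at hsum
      exact ENNReal.add_ne_top.2 ⟨hGt, ENNReal.add_ne_top.2 ⟨ENNReal.coe_ne_top,
        ENNReal.coe_ne_top⟩⟩ hsum.symm
    lift G to ℝ≥0 using hGt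
    lift Sp to ℝ≥0 using hSpt
    have h1 : (Sp : ℝ) + Sp = G + (Sn + Sn) := by exact_mod_cast hsum
    change ((Sp : ℝ) : EReal) - ((Sn : ℝ) : EReal) = ((1 / 2 : ℝ) : EReal) * ((G : ℝ) : EReal)
    rw [← EReal.coe_sub, ← EReal.coe_mul]
    congr 1
    linarith

end Entropy

/-! ### The finite-dimensional case -/

section FiniteDimensional

variable {H : Type*} [NormedAddCommGroup H] [InnerProductSpace ℂ H] [CompleteSpace H]

omit [CompleteSpace H] in
lemma finite_index_of_hilbertBasis [FiniteDimensional ℂ H] {κ : Type*} (b : HilbertBasis κ ℂ H) :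
    Finite κ :=
  b.orthonormal.linearIndependent.finite

lemma opTrace_eq_sum [FiniteDimensional ℂ H] {κ : Type*} [Fintype κ]
    (b : OrthonormalBasis κ ℂ H) (X : H →L[ℂ] H) : opTrace X = ∑ i, ⟪b i, X (b i)⟫_ℂ := by
  have := finite_index_of_hilbertBasis (onb H)
  have := Fintype.ofFinite (onbIndex H)
  have h1 := LinearMap.trace_eq_sum_inner (X : H →ₗ[ℂ] H) b
  have h2 := LinearMap.trace_eq_sum_inner (X : H →ₗ[ℂ] H) (onb H).toOrthonormalBasis
  rw [h1, HilbertBasis.coe_toOrthonormalBasis] at h2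
  rw [opTrace, tsum_fintype]
  exact h2.symm

omit [CompleteSpace H] in
lemma spectrum_real_finite [FiniteDimensional ℂ H] (A : H →L[ℂ] H) : (spectrum ℝ A).Finite := by
  have h1 : (spectrum ℂ A).Finite := by
    rw [← AlgEquiv.spectrum_eq (Module.End.toContinuousLinearMap H).symm A]
    exact Module.End.finite_spectrum _
  exact h1.preimage (FaithfulSMul.algebraMap_injective ℝ ℂ).injOn

omit [CompleteSpace H] in
lemma aeval_apply_of_apply_eq {A : H →L[ℂ] H} {r : ℝ} {x : H} (hx : A x = (r : ℂ) • x)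
    (p : Polynomial ℝ) : Polynomial.aeval A p x = ((p.eval r : ℝ) : ℂ) • x := by
  have hpow (n : ℕ) : (A ^ n) x = ((r ^ n : ℝ) : ℂ) • x := by
    induction n with
    | zero => simp
    | succ n ih =>
      rw [pow_succ]
      change (A ^ n) (A x) = _
      rw [hx, map_smul, ih, smul_smul]
      congr 1
      push_cast
      ring
  induction p using Polynomial.induction_on' with
  | add p q hp hq =>
    rw [map_add, add_apply, hp, hq, Polynomial.eval_add, Complex.ofReal_add, add_smul]
  | monomial n a =>
    rw [Polynomial.aeval_monomial, Polynomial.eval_monomial, ← Algebra.smul_def]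
    change a • (A ^ n) x = _
    rw [hpow, Complex.ofReal_mul, mul_smul]
    rfl

/-- In finite dimension the functional calculus is polynomial interpolation on the spectrum, so
`log A` acts as `log r` on the eigenspace at `r`; this includes the value `0` on the kernel. -/
lemma logOp_apply_of_apply_eq [FiniteDimensional ℂ H] {A : H →L[ℂ] H} (hA : IsSelfAdjoint A)
    {r : ℝ} {x : H} (hx : A x = (r : ℂ) • x) : logOp A x = (Real.log r : ℂ) • x := by
  classical
  -- The node `r` is added explicitly so that no case distinction on `x = 0` is needed.
  set S : Finset ℝ := insert r (spectrum_real_finite A).toFinset with hS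
  set p : Polynomial ℝ := Lagrange.interpolate S id Real.log with hp
  have heval (s : ℝ) (hs : s ∈ S) : p.eval s = Real.log s :=
    Lagrange.eval_interpolate_at_node (v := id) _ (Set.injOn_id _) hs
  have h1 : logOp A = Polynomial.aeval A p := by
    rw [logOp, CFC.log, ← cfc_polynomial p A]
    refine cfc_congr fun s hs => (heval s ?_).symm
    simp [hS, hs]
  rw [h1, aeval_apply_of_apply_eq hx, heval r (by simp [hS])]

/-- In orthonormal eigenbases `v` of `A` and `w` of `B` one has
`tr (P_r Q_s) = ∑ |⟨w_b, v_a⟩|²` over the pairs with eigenvalues `r` and `s`. -/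
lemma spectralTrace_eq_sum {A B : H →L[ℂ] H} (hA : IsSelfAdjoint A) (hB : IsSelfAdjoint B)
    {κ κ' : Type*} [Fintype κ] [Fintype κ'] (v : OrthonormalBasis κ ℂ H)
    (w : OrthonormalBasis κ' ℂ H) {c : κ → ℝ} {d : κ' → ℝ} (hv : ∀ a, A (v a) = (c a : ℂ) • v a)
    (hw : ∀ b, B (w b) = (d b : ℂ) • w b) (F : ℝ → ℝ → ℝ) :
    spectralTrace A B F = ((∑ a, ∑ b, ‖⟪w b, v a⟫_ℂ‖ ^ 2 * F (c a) (d b) : ℝ) : EReal) := by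
  classical
  have hP {A : H →L[ℂ] H} (hA : IsSelfAdjoint A) {c : ℝ} {x : H} (hx : A x = (c : ℂ) • x)
      (r : ℝ) : eigenProj A r x = if r = c then x else 0 := by
    split_ifs with h
    · rw [h, eigenProj_of_apply_eq hx]
    · exact eigenProj_of_apply_eq_of_ne hA h hx
  have ho (r s : ℝ) : overlap A B r s = ∑ a, ∑ b,
      if r = c a then if s = d b then ENNReal.ofReal (‖⟪w b, v a⟫_ℂ‖ ^ 2) else 0 else 0 := by
    rw [overlap_eq_hsSq_basis v.toHilbertBasis, hsSq, tsum_fintype]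
    refine Finset.sum_congr rfl fun a _ => ?_
    rw [ofReal_norm_sq_eq_tsum w.toHilbertBasis, tsum_fintype]
    refine Finset.sum_congr rfl fun b _ => ?_
    rw [OrthonormalBasis.coe_toHilbertBasis, OrthonormalBasis.coe_toHilbertBasis,
      ContinuousLinearMap.comp_apply, ← inner_eigenProj_left, hP hA (hv a), hP hB (hw b)]
    split_ifs <;> simp
  have hsum (f : ℝ → ℝ → ℝ) : ∑' r : ℝ, ∑' s : ℝ, overlap A B r s * ENNReal.ofReal (f r s) =
      ENNReal.ofReal (∑ a, ∑ b, ‖⟪w b, v a⟫_ℂ‖ ^ 2 * max (f (c a) (d b)) 0) := by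
    simp only [ho, Finset.sum_mul, ite_mul, zero_mul]
    rw [ENNReal.ofReal_sum_of_nonneg fun _ _ => Finset.sum_nonneg fun _ _ => by positivity]
    simp only [Summable.tsum_finsetSum fun _ _ => ENNReal.summable]
    refine Finset.sum_congr rfl fun a _ => ?_
    rw [ENNReal.ofReal_sum_of_nonneg fun _ _ => by positivity]
    refine Finset.sum_congr rfl fun b _ => ?_
    rw [tsum_eq_single (c a) fun r hr => by simp [hr], tsum_eq_single (d b) fun s hs => by simp [hs],
      if_pos rfl, if_pos rfl, ENNReal.ofReal_mul (by positivity)]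
    congr 1
    rcases le_total 0 (f (c a) (d b)) with h | h
    · rw [max_eq_left h]
    · rw [max_eq_right h, ENNReal.ofReal_of_nonpos h, ENNReal.ofReal_zero]
  rw [spectralTrace, hsum, hsum, EReal.coe_ennreal_ofReal, EReal.coe_ennreal_ofReal,
    max_eq_left (Finset.sum_nonneg fun _ _ => Finset.sum_nonneg fun _ _ => by positivity),
    max_eq_left (Finset.sum_nonneg fun _ _ => Finset.sum_nonneg fun _ _ => by positivity),
    ← EReal.coe_sub]
  congr 1
  simp only [← Finset.sum_sub_distrib, ← mul_sub]
  refine Finset.sum_congr rfl fun a _ => Finset.sum_congr rfl fun b _ => ?_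
  congr 1
  rcases le_total 0 (F (c a) (d b)) with h | h
  · rw [max_eq_left h, max_eq_right (neg_nonpos.2 h), sub_zero]
  · rw [max_eq_right h, max_eq_left (neg_nonneg.2 h), zero_sub, neg_neg]

/-- In finite dimension `symTrace` is the ordinary trace: both sides are evaluated in orthonormal
eigenbases `v` of `A` and `w` of `B`. -/
theorem symTrace_eq_opTrace [FiniteDimensional ℂ H] {A B : H →L[ℂ] H} (hA : IsSelfAdjoint A)
    (hB : IsSelfAdjoint B) :
    symTrace A B = (((opTrace ((A - B) ∘L (logOp A - logOp B))).re : ℝ) : EReal) := by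
  have hAs : (A : H →ₗ[ℂ] H).IsSymmetric := hA.isSymmetric
  have hBs : (B : H →ₗ[ℂ] H).IsSymmetric := hB.isSymmetric
  let v := hAs.eigenvectorBasis rfl
  let w := hBs.eigenvectorBasis rfl
  let c := hAs.eigenvalues rfl
  let d := hBs.eigenvalues rfl
  have hv (a) : A (v a) = (c a : ℂ) • v a := hAs.apply_eigenvectorBasis rfl a
  have hw (b) : B (w b) = (d b : ℂ) • w b := hBs.apply_eigenvectorBasis rfl b
  have hLs : IsSelfAdjoint (logOp B) := IsSelfAdjoint.log
  have hpair {X Y : H →L[ℂ] H} (hY : IsSelfAdjoint Y) {x y : ℝ} {a b}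
      (hx : X (v a) = (x : ℂ) • v a) (hy : Y (w b) = (y : ℂ) • w b) :
      ⟪w b, (X - Y) (v a)⟫_ℂ = ((x - y : ℝ) : ℂ) * ⟪w b, v a⟫_ℂ := by
    rw [sub_apply, inner_sub_right, hx, inner_smul_right,
      ← ContinuousLinearMap.adjoint_inner_left, hY.adjoint_eq, hy, inner_smul_left,
      Complex.conj_ofReal]
    push_cast
    ring
  have htr : opTrace ((A - B) ∘L (logOp A - logOp B)) = ((∑ a, ∑ b, ‖⟪w b, v a⟫_ℂ‖ ^ 2 *
      ((c a - d b) * (Real.log (c a) - Real.log (d b))) : ℝ) : ℂ) := by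
    rw [opTrace_eq_sum v, Complex.ofReal_sum]
    refine Finset.sum_congr rfl fun a _ => ?_
    rw [Complex.ofReal_sum, ContinuousLinearMap.comp_apply,
      ← ContinuousLinearMap.adjoint_inner_left, (hA.sub hB).adjoint_eq,
      ← w.sum_inner_mul_inner]
    refine Finset.sum_congr rfl fun b _ => ?_
    rw [← inner_conj_symm, hpair hB (hv a) (hw b),
      hpair hLs (logOp_apply_of_apply_eq hA (hv a)) (logOp_apply_of_apply_eq hB (hw b)),
      map_mul, Complex.conj_ofReal, Complex.ofReal_mul, Complex.ofReal_mul, Complex.ofReal_pow,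
      ← Complex.conj_mul']
    ring
  rw [htr, Complex.ofReal_re, symTrace, spectralTrace_eq_sum hA hB v w hv hw]

end FiniteDimensional

lemma finiteDimensional_HTensor {h : Type*} [NormedAddCommGroup h] [InnerProductSpace ℂ h]
    [CompleteSpace h] [FiniteDimensional ℂ h] : FiniteDimensional ℂ (HTensor h) := by
  obtain ⟨f, -⟩ := exists_htmul_basis (onb h) (onb h)
  have := finite_index_of_hilbertBasis (onb h)
  have := Fintype.ofFinite (onbIndex h × onbIndex h)
  exact f.toOrthonormalBasis.toBasis.finiteDimensional_of_finite

end

end QMS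

theorem mainTheorem6 {h : Type*} [NormedAddCommGroup h] [InnerProductSpace ℂ h] [CompleteSpace h]
    {ι : Type*} (e : HilbertBasis ι ℂ h)
    (ρ : h →L[ℂ] h) (hρ : QMS.IsState ρ) (hρf : QMS.IsFaithful ρ)
    (θ : h ≃ₗᵢ⋆[ℂ] h) (hθ : ∀ u, θ (θ u) = u) (hθρ : ∀ u, θ (ρ u) = ρ (θ u))
    (T TΘ : QMS.UniformQMS h) (hT : T.IsInvariant ρ) (hTΘ : T.IsThetaKMSAdjoint TΘ θ ρ)
    (t : ℝ≥0)
    (hker : (TΘ.choi e ρ t).ker ≤ (T.choi e ρ t).ker) :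
    (QMS.IsChoi e ρ (QMS.predual (T.map t)) (T.choi e ρ t) ∧ QMS.IsState (T.choi e ρ t)) ∧
    (QMS.IsChoi e ρ (QMS.predual (TΘ.map t)) (TΘ.choi e ρ t) ∧ QMS.IsState (TΘ.choi e ρ t)) ∧
    (TΘ.choi e ρ t).ker = (T.choi e ρ t).ker ∧
    QMS.relEntropy (T.choi e ρ t) (TΘ.choi e ρ t) =
      ((1 / 2 : ℝ) : EReal) * QMS.symTrace (T.choi e ρ t) (TΘ.choi e ρ t) ∧
    (FiniteDimensional ℂ h →
      QMS.relEntropy (T.choi e ρ t) (TΘ.choi e ρ t) =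
        ((1 / 2 * (QMS.opTrace ((T.choi e ρ t - TΘ.choi e ρ t) ∘L
          (QMS.logOp (T.choi e ρ t) - QMS.logOp (TΘ.choi e ρ t)))).re : ℝ) : EReal)) := by
  have h1 := QMS.isChoi_choi_and_isState (T.normal t) (T.map_one t) e hρ
  have h2 := QMS.isChoi_choi_and_isState (TΘ.normal t) (TΘ.map_one t) e hρ
  obtain ⟨W, hW, hWB⟩ := QMS.exists_involution_choi e hρ.1 hθ hθρ hTΘ t h1.1 h2.1
  have hrel := QMS.relEntropy_eq_half_symTrace h1.2 h2.2 hW hWB hker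
  refine ⟨h1, h2, le_antisymm hker fun x hx => ?_, hrel, fun hfin => ?_⟩
  · -- `ker J' = W (ker J)`, so the assumed inclusion says that `W` maps `ker J` into itself.
    have hx' : T.choi e ρ t x = 0 := hx
    have h3 : TΘ.choi e ρ t (W x) = 0 := by
      refine (hWB (W x)).trans ?_
      rw [hW]
      exact (congrArg W hx').trans (map_zero W)
    have h4 : T.choi e ρ t (W x) = 0 := hker h3
    exact (hWB x).trans ((congrArg W h4).trans (map_zero W))
  · have := QMS.finiteDimensional_HTensor (h := h)
    refine hrel.trans ?_
    have h5 := QMS.symTrace_eq_opTrace h1.2.1.isSelfAdjoint h2.2.1.isSelfAdjoint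
    refine (congrArg _ h5).trans ?_
    rw [← EReal.coe_mul]
    rfl
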